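/- Let $G$ be a discrete group with identity $e$, let $B$ be a unital C$^*$-algebra, and let $\operatorname{Pic}(B)$ be its Picard group: the group of isomorphism classes of Morita equivalence (imprimitivity) $B$-bimodules, where isomorphisms are the $B$-bimodule isomorphisms that preserve both the left inner product ${}_B\langle\cdot,\cdot\rangle$ and the right inner product $\langle\cdot,\cdot\rangle_B$, with the internal tensor product $\otimes_B$ as multiplication. Let $\psi:G\to\operatorname{Pic}(B)$ be a group homomorphism, and let $(B_g,\Psi_{g,h})_{g,h\in G}$ be a factor system for $\psi$, that is: for every $g\in G$, $B_g$ is a representative of $\psi(g)$, with $B_e=B$; for all $g,h\in G$, $\Psi_{g,h}:B_g\otimes_B B_h\to B_{gh}$ is an isomorphism of Morita equivalence $B$-bimodules, with $\Psi_{e,e}=\mathrm{id}_B$ (under $B\otimes_B B\cong B$, $a\otimes b\mapsto ab$); and $$\Psi_{gh,k}\circ(\Psi_{g,h}\otimes\mathrm{id}_{B_k})=\Psi_{g,hk}\circ(\mathrm{id}_{B_g}\otimes\Psi_{h,k})\qquad\text{for all } g,h,k\in G.$$ Let $\mathcal B=\bigsqcup_{g\in G}B_g$, with the disjoint union of the norm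 topologies, and let $\pi:\mathcal B\to G$ be the canonical projection. For $s\in B_g$, $t\in B_h$ put $m(s,t):=\Psi_{g,h}(s\otimes t)\in B_{gh}$. For $s\in B_g$ let $\lambda_s:B_{g^{-1}}\to B_e=B$, $\lambda_s(t):=\Psi_{g,g^{-1}}(s\otimes t)$. Then every $\lambda_s$ is adjointable as a map of right Hilbert $B$-modules, and with the multiplication $m$ and the involution $s^*:=\lambda_s^*(1_B)\in B_{g^{-1}}$ (for $s\in B_g$), $\pi:\mathcal B\to G$ is a saturated Fell bundle whose unit fiber is the C$^*$-algebra $B$. That is, $(\mathcal B,G,\pi)$ is a Banach bundle; $m$ and ${}^*$ are continuous; $m$ is associative and bilinear as a map $B_g\times B_h\to B_{gh}$; ${}^*:B_g\to B_{g^{-1}}$ is anti-linear; for all $s,t\in\mathcal B$ one has $\|st\|\le\|s\|\,\|t\|$, $(st)^*=t^*s^*$, $(s^*)^*=s$, $\|s^*s\|=\|s\|^2$ and $s^*s\ge 0$ in $B_e$; the linear span of $B_gB_h$ is dense in $B_{gh}$ for all $g,h\in G$; and on $B_e=B$ the operations and the norm of the bundle are those of $B$. -/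

import Mathlib

universe u

noncomputable section

open scoped TensorProduct RightActions

/-- A Morita equivalence `B`-bimodule (imprimitivity bimodule) over a unital C⋆-algebra `B`:
a Banach space `M` with commuting left and right actions of `B`, a left `B`-valued inner product
`innerL` (linear in the first variable) and a right `B`-valued inner product `innerR` (linear in
the second variable), such that `M` is a full left Hilbert `B`-module and a full right Hilbert
`B`-module, each action is by adjointable operators for the other inner product, and
`innerL x y • z = x • innerR y z`. The right action of `b` on `x` is written `x <• b`. -/
structure MoritaBimodule (B : Type u) [CStarAlgebra B] [PartialOrder B] [StarOrderedRing B] where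
  carrier : Type u
  [normedAddCommGroup : NormedAddCommGroup carrier]
  [normedSpace : NormedSpace ℂ carrier]
  [completeSpace : CompleteSpace carrier]
  [leftModule : Module B carrier]
  [rightModule : Module Bᵐᵒᵖ carrier]
  [smulCommClass : SMulCommClass B Bᵐᵒᵖ carrier]
  [isScalarTowerLeft : IsScalarTower ℂ B carrier]
  [isScalarTowerRight : IsScalarTower ℂ Bᵐᵒᵖ carrier]
  /-- the left inner product -/
  innerL : carrier → carrier → B
  /-- the right inner product -/
  innerR : carrier → carrier → B
  innerL_add_left : ∀ x y z, innerL (x + y) z = innerL x z + innerL y z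
  innerL_smul_left : ∀ (b : B) x y, innerL (b • x) y = b * innerL x y
  star_innerL : ∀ x y, star (innerL x y) = innerL y x
  innerL_self_nonneg : ∀ x, 0 ≤ innerL x x
  norm_sq_eq_innerL : ∀ x, ‖x‖ ^ 2 = ‖innerL x x‖
  fullL : Dense (Submodule.span ℂ {b : B | ∃ x y, innerL x y = b} : Set B)
  innerR_add_right : ∀ x y z, innerR x (y + z) = innerR x y + innerR x z
  innerR_smul_right : ∀ (b : B) x y, innerR x (y <• b) = innerR x y * b
  star_innerR : ∀ x y, star (innerR x y) = innerR y x
  innerR_self_nonneg : ∀ x, 0 ≤ innerR x x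
  norm_sq_eq_innerR : ∀ x, ‖x‖ ^ 2 = ‖innerR x x‖
  fullR : Dense (Submodule.span ℂ {b : B | ∃ x y, innerR x y = b} : Set B)
  innerR_smul_left_adjoint : ∀ (b : B) x y, innerR (b • x) y = innerR x (star b • y)
  innerL_smul_right_adjoint : ∀ (b : B) x y, innerL (x <• b) y = innerL x (y <• star b)
  innerL_smul_eq : ∀ x y z, innerL x y • z = x <• innerR y z

namespace MoritaBimodule

variable {B : Type u} [CStarAlgebra B] [PartialOrder B] [StarOrderedRing B]

instance : CoeSort (MoritaBimodule B) (Type u) := ⟨carrier⟩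

attribute [instance] normedAddCommGroup normedSpace completeSpace leftModule rightModule
  smulCommClass isScalarTowerLeft isScalarTowerRight

section basics

variable (M : MoritaBimodule B)

lemma innerL_add_right (x y z : M) : M.innerL x (y + z) = M.innerL x y + M.innerL x z := by
  rw [← M.star_innerL, M.innerL_add_left, star_add, M.star_innerL, M.star_innerL]

lemma innerR_add_left (x y z : M) : M.innerR (x + y) z = M.innerR x z + M.innerR y z := by
  rw [← M.star_innerR, M.innerR_add_right, star_add, M.star_innerR, M.star_innerR]

lemma innerL_smul_right (b : B) (x y : M) : M.innerL x (b • y) = M.innerL x y * star b := by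
  rw [← M.star_innerL, M.innerL_smul_left, star_mul, M.star_innerL]

lemma innerR_smul_left (b : B) (x y : M) : M.innerR (x <• b) y = star b * M.innerR x y := by
  rw [← M.star_innerR, M.innerR_smul_right, star_mul, M.star_innerR]

/-- The left inner product as a biadditive map. -/
def innerLHom : M →+ M →+ B :=
  AddMonoidHom.mk' (fun x => AddMonoidHom.mk' (M.innerL x) (M.innerL_add_right x))
    fun x y => by ext z; exact M.innerL_add_left x y z

/-- The right inner product as a biadditive map. -/
def innerRHom : M →+ M →+ B :=
  AddMonoidHom.mk' (fun x => AddMonoidHom.mk' (M.innerR x) (M.innerR_add_right x))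
    fun x y => by ext z; exact M.innerR_add_left x y z

@[simp] lemma innerLHom_apply (x y : M) : M.innerLHom x y = M.innerL x y := rfl
@[simp] lemma innerRHom_apply (x y : M) : M.innerRHom x y = M.innerR x y := rfl

lemma innerL_sub_left (x y z : M) : M.innerL (x - y) z = M.innerL x z - M.innerL y z :=
   DFunLike.congr_fun (map_sub M.innerLHom x y) z

lemma innerL_sub_right (x y z : M) : M.innerL x (y - z) = M.innerL x y - M.innerL x z :=
  map_sub (M.innerLHom x) y z

lemma innerL_sum_left {ι : Type*} (s : Finset ι) (f : ι → M) (y : M) :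
    M.innerL (∑ i ∈ s, f i) y = ∑ i ∈ s, M.innerL (f i) y :=
  map_sum (M.innerLHom.flip y) f s

lemma innerR_sum_right {ι : Type*} (s : Finset ι) (f : ι → M) (y : M) :
    M.innerR y (∑ i ∈ s, f i) = ∑ i ∈ s, M.innerR y (f i) :=
  map_sum (M.innerRHom y) f s

lemma algebraMap_smul' (c : ℂ) (x : M) : (algebraMap ℂ B c) • x = c • x := algebraMap_smul B c x

lemma smul_algebraMap' (c : ℂ) (x : M) : x <• (algebraMap ℂ B c) = c • x := by
  rw [Algebra.algebraMap_eq_smul_one, MulOpposite.op_smul, smul_assoc, MulOpposite.op_one, one_smul]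

lemma norm_smul_le_aux (b : B) (x : M) : ‖b • x‖ ≤ ‖b‖ * ‖x‖ := by
  refine (pow_le_pow_iff_left₀ (norm_nonneg _) (by positivity) two_ne_zero).1 ?_
  rw [M.norm_sq_eq_innerL, M.innerL_smul_left, M.innerL_smul_right, ← mul_assoc, mul_pow,
    M.norm_sq_eq_innerL]
  calc _ ≤ ‖b‖ * ‖M.innerL x x‖ * ‖star b‖ := by
        refine (norm_mul_le _ _).trans ?_
        gcongr
        exact norm_mul_le _ _
    _ = _ := by rw [norm_star]; ring

lemma exists_sum_of_mem_span {a : B}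
    (ha : a ∈ Submodule.span ℂ {b : B | ∃ x y, M.innerL x y = b}) :
    ∃ (n : ℕ) (x y : Fin n → M), ∑ i, M.innerL (x i) (y i) = a := by
  induction ha using Submodule.span_induction with
  | mem a h =>
    obtain ⟨x, y, rfl⟩ := h
    exact ⟨1, fun _ => x, fun _ => y, by simp⟩
  | zero => exact ⟨0, 0, 0, by simp⟩
  | add a b _ _ h1 h2 =>
    obtain ⟨n, x, y, rfl⟩ := h1
    obtain ⟨m, x', y', rfl⟩ := h2
    exact ⟨n + m, Fin.append x x', Fin.append y y', by simp [Fin.sum_univ_add]⟩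
  | smul c a _ h =>
    obtain ⟨n, x, y, rfl⟩ := h
    refine ⟨n, fun i => (algebraMap ℂ B c) • x i, y, ?_⟩
    simp only [M.innerL_smul_left, Finset.smul_sum, Algebra.algebraMap_eq_smul_one,
      smul_one_mul]

lemma exists_sum_eq_one : ∃ (n : ℕ) (x y : Fin n → M), ∑ i, M.innerL (x i) (y i) = 1 := by
  obtain ⟨a, ha, ha'⟩ := Metric.dense_iff.1 M.fullL 1 1 one_pos
  obtain ⟨n, x, y, rfl⟩ := M.exists_sum_of_mem_span ha'
  have hu : IsUnit (∑ i, M.innerL (x i) (y i)) := by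
    rw [Metric.mem_ball, dist_comm, dist_eq_norm] at ha
    simpa using isUnit_one_sub_of_norm_lt_one ha
  obtain ⟨b, -, hb⟩ := isUnit_iff_exists.1 hu
  refine ⟨n, fun i => b • x i, y, ?_⟩
  simpa only [M.innerL_smul_left, Finset.mul_sum] using hb

/-- Fullness of the left inner product in the form used for the tensor product. -/
lemma exists_frame_left :
    ∃ (n : ℕ) (w : Fin n → M), ∑ i, M.innerL (w i) (w i) = 1 := by
  obtain ⟨n, x, y, hxy⟩ := M.exists_sum_eq_one
  have hyx : ∑ i, M.innerL (y i) (x i) = 1 := by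
    simpa [star_sum, M.star_innerL] using congrArg star hxy
  set c : B := ∑ i, M.innerL (x i) (x i) + ∑ i, M.innerL (y i) (y i) with hc
  have h2 : 1 ≤ c := by
    have h : 0 ≤ ∑ i, M.innerL (x i - y i) (x i - y i) :=
      Finset.sum_nonneg fun i _ => M.innerL_self_nonneg _
    have h' : ∑ i, M.innerL (x i - y i) (x i - y i) = c - (1 + 1) := by
      simp only [M.innerL_sub_left, M.innerL_sub_right, Finset.sum_sub_distrib, hxy, hyx, hc]
      abel
    rw [h', sub_nonneg] at h
    exact (le_add_of_nonneg_right zero_le_one).trans h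
  have hcs : IsStrictlyPositive c :=
    ⟨zero_le_one.trans h2, CStarAlgebra.isUnit_of_le 1 h2⟩
  set d : B := c ^ (-(1 / 2) : ℝ) with hd
  have hds : star d = d := (IsSelfAdjoint.of_nonneg CFC.rpow_nonneg).star_eq
  have h1 : d * c * d = 1 := CFC.conjugate_rpow_neg_one_half c
  refine ⟨n + n, Fin.append (fun i => d • x i) (fun i => d • y i), ?_⟩
  simp only [Fin.sum_univ_add, Fin.append_left, Fin.append_right, M.innerL_smul_left,
    M.innerL_smul_right, hds, ← mul_assoc, ← Finset.sum_mul, ← Finset.mul_sum]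
  rw [← h1, hc]
  simp only [mul_add, add_mul, Finset.mul_sum]

end basics

section self

/-- The trivial Morita equivalence bimodule `B`, with `innerL a b = a * b⋆` and
`innerR a b = a⋆ * b`. -/
def self (B : Type u) [CStarAlgebra B] [PartialOrder B] [StarOrderedRing B] :
    MoritaBimodule B where
  carrier := B
  innerL a b := a * star b
  innerR a b := star a * b
  innerL_add_left := by intros; exact add_mul _ _ _
  innerL_smul_left := by intros; exact mul_assoc _ _ _
  star_innerL := by simp
  innerL_self_nonneg := mul_star_self_nonneg
  norm_sq_eq_innerL x := by rw [CStarRing.norm_self_mul_star, sq]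
  fullL := by
    refine dense_univ.mono fun b _ => Submodule.subset_span ⟨b, 1, by simp⟩
  innerR_add_right := by intros; exact mul_add _ _ _
  innerR_smul_right := by intros; exact (mul_assoc _ _ _).symm
  star_innerR := by simp
  innerR_self_nonneg := star_mul_self_nonneg
  norm_sq_eq_innerR x := by rw [CStarRing.norm_star_mul_self, sq]
  fullR := by
    refine dense_univ.mono fun b _ => Submodule.subset_span ⟨1, b, by simp⟩
  innerR_smul_left_adjoint := by simp [mul_assoc]
  innerL_smul_right_adjoint := by simp [mul_assoc]
  innerL_smul_eq := by simp [mul_assoc]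

end self

section conj

/-- The underlying type of the conjugate bimodule. -/
def ConjCarrier (M : MoritaBimodule B) : Type u := M

variable (M : MoritaBimodule B)

instance : NormedAddCommGroup M.ConjCarrier := M.normedAddCommGroup
instance : CompleteSpace M.ConjCarrier := M.completeSpace
instance : Module B M.ConjCarrier :=
  Module.compHom M.carrier (starRingEquiv : B ≃+* Bᵐᵒᵖ).toRingHom
instance : Module Bᵐᵒᵖ M.ConjCarrier :=
  Module.compHom M.carrier (starRingEquiv : B ≃+* Bᵐᵒᵖ).symm.toRingHom
instance : NormedSpace ℂ M.ConjCarrier :=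
  { Module.compHom M.carrier (starRingEnd ℂ) with
    norm_smul_le := fun c x => by
      refine (norm_smul_le (starRingEnd ℂ c) (show M.carrier from x)).trans_eq ?_
      rw [RCLike.norm_conj]
      rfl }

/-- The identity map from `M` to the underlying type of the conjugate bimodule. -/
def toConj : M ≃+ M.ConjCarrier := AddEquiv.refl M

lemma smul_toConj (b : B) (x : M) : b • M.toConj x = M.toConj (x <• star b) := rfl
lemma toConj_smul (b : B) (x : M) : M.toConj x <• b = M.toConj (star b • x) := rfl
lemma complex_smul_toConj (c : ℂ) (x : M) : c • M.toConj x = M.toConj (star c • x) := rfl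

/-- The conjugate Morita equivalence bimodule, with `b • x̃ = (x <• b⋆)~`, `x̃ <• b = (b⋆ • x)~` and
with the two inner products interchanged. -/
def conj : MoritaBimodule B where
  carrier := M.ConjCarrier
  smulCommClass := ⟨fun b c x => (smul_comm (star c.unop) (MulOpposite.op (star b))
    (M.toConj.symm x)).symm⟩
  isScalarTowerLeft := ⟨fun c b x => by
    obtain ⟨x, rfl⟩ := M.toConj.surjective x
    simp only [smul_toConj, complex_smul_toConj, star_smul, MulOpposite.op_smul, smul_assoc]⟩
  isScalarTowerRight := ⟨fun c b x => by
    obtain ⟨x, rfl⟩ := M.toConj.surjective x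
    obtain ⟨b, rfl⟩ := MulOpposite.op_surjective b
    rw [← MulOpposite.op_smul]
    simp only [toConj_smul, complex_smul_toConj, star_smul, smul_assoc]⟩
  innerL x y := M.innerR (M.toConj.symm x) (M.toConj.symm y)
  innerR x y := M.innerL (M.toConj.symm x) (M.toConj.symm y)
  innerL_add_left x y z := M.innerR_add_left _ _ _
  innerL_smul_left b x y := (M.innerR_smul_left _ _ _).trans (congrArg (· * _) (star_star b))
  star_innerL x y := M.star_innerR _ _
  innerL_self_nonneg x := M.innerR_self_nonneg _
  norm_sq_eq_innerL x := M.norm_sq_eq_innerR _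
  fullL := M.fullR
  innerR_add_right x y z := M.innerL_add_right _ _ _
  innerR_smul_right b x y := (M.innerL_smul_right _ _ _).trans (congrArg (_ * ·) (star_star b))
  star_innerR x y := M.star_innerL _ _
  innerR_self_nonneg x := M.innerL_self_nonneg _
  norm_sq_eq_innerR x := M.norm_sq_eq_innerL _
  fullR := M.fullL
  innerR_smul_left_adjoint b x y := M.innerL_smul_right_adjoint _ _ _
  innerL_smul_right_adjoint b x y := M.innerR_smul_left_adjoint _ _ _
  innerL_smul_eq x y z := by
    have h := M.innerL_smul_eq (M.toConj.symm z) (M.toConj.symm y) (M.toConj.symm x)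
    change MulOpposite.op (star (M.innerR (M.toConj.symm x) (M.toConj.symm y))) •
      (M.toConj.symm z) = star (M.innerL (M.toConj.symm y) (M.toConj.symm z)) • (M.toConj.symm x)
    rw [M.star_innerR, M.star_innerL, h]

lemma exists_frame_right :
    ∃ (n : ℕ) (w : Fin n → M), ∑ i, M.innerR (w i) (w i) = 1 :=
  M.conj.exists_frame_left

lemma conjTensor_aux_left (m n m' n' : M) :
    M.innerR m n * star (M.innerR m' n') = M.innerR (star (M.innerL n n') • m) m' := by
  rw [M.star_innerR, M.star_innerL, M.innerR_smul_left_adjoint, M.star_innerL,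
    M.innerL_smul_eq, M.innerR_smul_right]

lemma conjTensor_aux_right (m n m' n' : M) :
    star (M.innerR m n) * M.innerR m' n' = M.innerR n (M.innerL m m' • n') := by
  rw [M.star_innerR, M.innerL_smul_eq, M.innerR_smul_right]

end conj


section tensor

variable (M N : MoritaBimodule B)

/-- The subspace of `M ⊗[ℂ] N` spanned by the elements `(m <• b) ⊗ n - m ⊗ (b • n)`. -/
def balancedRel : Submodule ℂ (M ⊗[ℂ] N) :=
  { AddSubgroup.closure {x : M ⊗[ℂ] N | ∃ (m : M) (b : B) (n : N),
      (m <• b) ⊗ₜ[ℂ] n - m ⊗ₜ[ℂ] (b • n) = x} with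
    smul_mem' := fun c x hx => by
      change c • x ∈ AddSubgroup.closure _
      change x ∈ AddSubgroup.closure _ at hx
      induction hx using AddSubgroup.closure_induction with
      | mem x hx =>
        obtain ⟨m, b, n, rfl⟩ := hx
        refine AddSubgroup.subset_closure ⟨c • m, b, n, ?_⟩
        rw [smul_sub, TensorProduct.smul_tmul', TensorProduct.smul_tmul', smul_comm]
      | zero => rw [smul_zero]; exact zero_mem _
      | add x y _ _ hx hy => rw [smul_add]; exact add_mem hx hy
      | neg x _ hx => rw [smul_neg]; exact neg_mem hx }

/-- The balanced tensor product `M ⊗_B N`. -/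
def TensorCarrier : Type u := (M ⊗[ℂ] N) ⧸ balancedRel M N

instance : AddCommGroup (TensorCarrier M N) :=
  inferInstanceAs (AddCommGroup ((M ⊗[ℂ] N) ⧸ balancedRel M N))
instance : Module ℂ (TensorCarrier M N) :=
  inferInstanceAs (Module ℂ ((M ⊗[ℂ] N) ⧸ balancedRel M N))

variable {M N}

/-- The elementary tensor `m ⊗ n` in `M ⊗_B N`. -/
def tmul (m : M) (n : N) : TensorCarrier M N := (balancedRel M N).mkQ (m ⊗ₜ[ℂ] n)

lemma tmul_add (m : M) (n n' : N) : tmul m (n + n') = tmul m n + tmul m n' := by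
  simp only [tmul, TensorProduct.tmul_add]; rfl

lemma add_tmul (m m' : M) (n : N) : tmul (m + m') n = tmul m n + tmul m' n := by
  simp only [tmul, TensorProduct.add_tmul]; rfl

lemma tmul_zero (m : M) : tmul m (0 : N) = 0 := by
  simp only [tmul, TensorProduct.tmul_zero]; rfl

lemma zero_tmul (n : N) : tmul (0 : M) n = 0 := by
  simp only [tmul, TensorProduct.zero_tmul]; rfl

lemma complex_smul_tmul (c : ℂ) (m : M) (n : N) : c • tmul m n = tmul (c • m) n := by
  simp only [tmul, ← TensorProduct.smul_tmul']; rfl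

lemma smul_tmul (m : M) (b : B) (n : N) : tmul (m <• b) n = tmul m (b • n) :=
  (Submodule.Quotient.eq (balancedRel M N)).2 (AddSubgroup.subset_closure ⟨m, b, n, rfl⟩)

lemma tensor_induction {p : TensorCarrier M N → Prop} (x : TensorCarrier M N)
    (zero : p 0) (tmul : ∀ m n, p (tmul m n)) (add : ∀ x y, p x → p y → p (x + y)) : p x := by
  obtain ⟨x, rfl⟩ := (balancedRel M N).mkQ_surjective x
  induction x using TensorProduct.induction_on with
  | zero => rw [map_zero]; exact zero
  | tmul m n => exact tmul m n
  | add x y hx hy => rw [map_add]; exact add _ _ hx hy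

/-- The universal property of `M ⊗_B N` for balanced biadditive maps. -/
def tensorLift {P : Type*} [AddCommGroup P] (f : M →+ N →+ P)
    (hf : ∀ m (b : B) n, f (m <• b) n = f m (b • n)) : TensorCarrier M N →+ P :=
  QuotientAddGroup.lift (balancedRel M N).toAddSubgroup
    (TensorProduct.liftAddHom f fun c m n => by
      rw [← smul_algebraMap', hf, algebraMap_smul']) fun x hx => by
    refine (AddSubgroup.closure_le _).2 ?_ hx
    rintro _ ⟨m, b, n, rfl⟩
    refine (map_sub _ _ _).trans (sub_eq_zero.2 ?_)
    exact hf m b n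

@[simp] lemma tensorLift_tmul {P : Type*} [AddCommGroup P] (f : M →+ N →+ P)
    (hf : ∀ m (b : B) n, f (m <• b) n = f m (b • n)) (m : M) (n : N) :
    tensorLift f hf (tmul m n) = f m n := rfl

/-- Biadditive maps from functions additive in each variable. -/
def mkBiadd {X Y Z : Type*} [AddCommGroup X] [AddCommGroup Y] [AddCommGroup Z] (f : X → Y → Z)
    (h1 : ∀ x x' y, f (x + x') y = f x y + f x' y)
    (h2 : ∀ x y y', f x (y + y') = f x y + f x y') : X →+ Y →+ Z :=
  AddMonoidHom.mk' (fun x => AddMonoidHom.mk' (f x) (h2 x)) fun x x' => by ext y; exact h1 x x' y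

@[simp] lemma mkBiadd_apply {X Y Z : Type*} [AddCommGroup X] [AddCommGroup Y] [AddCommGroup Z]
    (f : X → Y → Z) (h1 : ∀ x x' y, f (x + x') y = f x y + f x' y)
    (h2 : ∀ x y y', f x (y + y') = f x y + f x y') (x : X) (y : Y) :
    mkBiadd f h1 h2 x y = f x y := rfl

lemma tensor_addHom_ext {P : Type*} [AddCommGroup P] {f g : TensorCarrier M N →+ P}
    (h : ∀ m n, f (tmul m n) = g (tmul m n)) : f = g := by
  ext x
  induction x using tensor_induction with
  | zero => simp
  | tmul m n => exact h m n
  | add x y hx hy => rw [map_add, map_add, hx, hy]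

/-- Left multiplication by `b` on `M ⊗_B N`. -/
def tensorSMul (b : B) : TensorCarrier M N →+ TensorCarrier M N :=
  tensorLift (mkBiadd (fun m n => tmul (b • m) n) (fun m m' n => by rw [smul_add, add_tmul])
    fun m n n' => tmul_add _ _ _) fun m c n => by
      simp only [mkBiadd_apply, ← smul_tmul, smul_comm]

/-- Right multiplication by `b` on `M ⊗_B N`. -/
def tensorRSMul (b : B) : TensorCarrier M N →+ TensorCarrier M N :=
  tensorLift (mkBiadd (fun m n => tmul m (n <• b)) (fun m m' n => add_tmul _ _ _)
    fun m n n' => by rw [smul_add, tmul_add]) fun m c n => by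
      simp only [mkBiadd_apply, smul_tmul, smul_comm]

instance : Module B (TensorCarrier M N) where
  smul b x := tensorSMul b x
  one_smul x := DFunLike.congr_fun (g := AddMonoidHom.id _)
    (tensor_addHom_ext fun m n => congrArg (tmul · n) (one_smul B m)) x
  mul_smul b c x := DFunLike.congr_fun (g := (tensorSMul b).comp (tensorSMul c))
    (tensor_addHom_ext fun m n => congrArg (tmul · n) (mul_smul b c m)) x
  smul_zero b := map_zero (tensorSMul b)
  smul_add b := map_add (tensorSMul b)
  add_smul b c x := DFunLike.congr_fun (g := tensorSMul b + tensorSMul c)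
    (tensor_addHom_ext fun m n =>
      (congrArg (tmul · n) (add_smul b c m)).trans (add_tmul _ _ _)) x
  zero_smul x := DFunLike.congr_fun (g := 0)
    (tensor_addHom_ext fun m n => (congrArg (tmul · n) (zero_smul B m)).trans
      (zero_tmul n)) x

instance : Module Bᵐᵒᵖ (TensorCarrier M N) where
  smul b x := tensorRSMul b.unop x
  one_smul x := DFunLike.congr_fun (g := AddMonoidHom.id _)
    (tensor_addHom_ext fun m n => congrArg (tmul m ·) (one_smul Bᵐᵒᵖ n)) x
  mul_smul b c x := DFunLike.congr_fun (g := (tensorRSMul b.unop).comp (tensorRSMul c.unop))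
    (tensor_addHom_ext fun m n => congrArg (tmul m ·) (mul_smul b c n)) x
  smul_zero b := map_zero (tensorRSMul b.unop)
  smul_add b := map_add (tensorRSMul b.unop)
  add_smul b c x := DFunLike.congr_fun (g := tensorRSMul b.unop + tensorRSMul c.unop)
    (tensor_addHom_ext fun m n =>
      (congrArg (tmul m ·) (add_smul b c n)).trans (tmul_add _ _ _)) x
  zero_smul x := DFunLike.congr_fun (g := 0)
    (tensor_addHom_ext fun m n => (congrArg (tmul m ·) (zero_smul Bᵐᵒᵖ n)).trans
      (tmul_zero m)) x

lemma smul_tmul_left (b : B) (m : M) (n : N) : b • tmul m n = tmul (b • m) n := rfl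
lemma tmul_smul_right (b : B) (m : M) (n : N) : tmul m n <• b = tmul m (n <• b) := rfl

instance : SMulCommClass B Bᵐᵒᵖ (TensorCarrier M N) := ⟨fun b c x => by
  induction x using tensor_induction with
  | zero => simp
  | tmul m n => rfl
  | add x y hx hy => simp only [smul_add, hx, hy]⟩

instance : IsScalarTower ℂ B (TensorCarrier M N) := ⟨fun c b x => by
  induction x using tensor_induction with
  | zero => simp
  | tmul m n => rw [smul_tmul_left, smul_tmul_left, complex_smul_tmul, smul_assoc]
  | add x y hx hy => simp only [smul_add, hx, hy]⟩

lemma complex_smul_tmul' (c : ℂ) (m : M) (n : N) : c • tmul m n = tmul m (c • n) := by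
  rw [complex_smul_tmul, ← smul_algebraMap', smul_tmul, algebraMap_smul']

instance : IsScalarTower ℂ Bᵐᵒᵖ (TensorCarrier M N) := ⟨fun c b x => by
  induction x using tensor_induction with
  | zero => simp
  | tmul m n =>
    obtain ⟨b, rfl⟩ := MulOpposite.op_surjective b
    rw [← MulOpposite.op_smul, tmul_smul_right, tmul_smul_right, complex_smul_tmul',
      MulOpposite.op_smul, smul_assoc]
  | add x y hx hy => simp only [smul_add, hx, hy]⟩


lemma norm_innerL_le_aux {X : Type*} [AddCommGroup X] [Module ℂ X] [Module B X] [Module Bᵐᵒᵖ X]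
    [IsScalarTower ℂ B X] [IsScalarTower ℂ Bᵐᵒᵖ X] (iL : X →+ X →+ B) (iR : X →+ X →+ B)
    (hl : ∀ (b : B) x y, iL (b • x) y = b * iL x y)
    (hstar : ∀ x y, star (iL x y) = iL y x) (hnn : ∀ x, 0 ≤ iL x x)
    (hadj : ∀ (b : B) x y, iL (x <• b) y = iL x (y <• star b))
    (hRstar : ∀ x, star (iR x x) = iR x x)
    (hc : ∀ x y z, iL x y • z = x <• iR y z) (x : X) : ‖iL x x‖ ≤ ‖iR x x‖ := by
  set a := iL x x with ha
  set b := iR x x with hb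
  have hsa : IsSelfAdjoint a := hstar x x
  have hsb : IsSelfAdjoint b := hRstar x
  obtain ⟨c, hc'⟩ := CStarAlgebra.nonneg_iff_eq_mul_star_self.1
    (sub_nonneg.2 (CStarAlgebra.mul_star_le_algebraMap_norm_sq (a := b)))
  rw [hsb.star_eq] at hc'
  have hop : ∀ (r : ℝ) (y : X), y <• (algebraMap ℝ B r) = (algebraMap ℝ B r) • y := by
    intro r y
    rw [IsScalarTower.algebraMap_apply ℝ ℂ B, algebraMap_smul,
      Algebra.algebraMap_eq_smul_one (A := B), MulOpposite.op_smul, smul_assoc,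
      MulOpposite.op_one, one_smul]
  have h3 : a * a * a = algebraMap ℝ B (‖b‖ ^ 2) * a - iL (x <• c) (x <• c) := by
    have e1 : iL (x <• c) (x <• c) = iL (x <• (c * star c)) x := by
      rw [MulOpposite.op_mul, mul_smul, hadj (star c), star_star]
    have e2 : iL (x <• (b * b)) x = a * a * a := by
      have e3 : x <• b = a • x := (hc x x x).symm
      calc iL (x <• (b * b)) x = iL ((x <• b) <• b) x := by rw [MulOpposite.op_mul, mul_smul]
        _ = iL (x <• b) (x <• b) := by rw [hadj, hsb.star_eq]
        _ = a * iL x (a • x) := by rw [e3, hl]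
        _ = a * (a * a) := by rw [← hstar, hl, ← ha, star_mul, hsa.star_eq]
        _ = a * a * a := (mul_assoc _ _ _).symm
    rw [e1, ← hc', MulOpposite.op_sub, sub_smul, map_sub, AddMonoidHom.sub_apply, e2, hop, hl,
      ← ha]
    abel
  have h4 : a * a * a ≤ algebraMap ℝ B (‖b‖ ^ 2) * a := by
    rw [h3]; exact sub_le_self _ (hnn _)
  have h5 : 0 ≤ a * a * a := by
    have := star_left_conjugate_nonneg (hnn x) a
    rwa [hsa.star_eq] at this
  have h6 : ‖a * a * a‖ ≤ ‖b‖ ^ 2 * ‖a‖ := by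
    refine (CStarAlgebra.norm_le_norm_of_nonneg_of_le h5 h4).trans_eq ?_
    rw [← Algebra.smul_def, norm_smul, Real.norm_of_nonneg (by positivity)]
  have h7 : ‖a‖ ^ 4 ≤ ‖b‖ ^ 2 * ‖a‖ * ‖a‖ := by
    have h8 : IsSelfAdjoint (a * a) := by
      rw [IsSelfAdjoint, star_mul, hsa.star_eq]
    calc ‖a‖ ^ 4 = ‖a * a * a * a‖ := by
          rw [mul_assoc (a * a), h8.norm_mul_self, hsa.norm_mul_self]; ring
      _ ≤ _ := (norm_mul_le _ _).trans (by gcongr)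
  by_contra! hlt
  have hpos : 0 < ‖a‖ := (norm_nonneg _).trans_lt hlt
  have : ‖b‖ ^ 2 < ‖a‖ ^ 2 := by gcongr
  nlinarith [mul_lt_mul_of_pos_right this (pow_pos hpos 2)]

lemma norm_innerR_le_aux {X : Type*} [AddCommGroup X] [Module ℂ X] [Module B X] [Module Bᵐᵒᵖ X]
    [IsScalarTower ℂ B X] [IsScalarTower ℂ Bᵐᵒᵖ X] (iL : X →+ X →+ B) (iR : X →+ X →+ B)
    (hr : ∀ (b : B) x y, iR x (y <• b) = iR x y * b)
    (hstar : ∀ x y, star (iR x y) = iR y x) (hnn : ∀ x, 0 ≤ iR x x)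
    (hadj : ∀ (b : B) x y, iR (b • x) y = iR x (star b • y))
    (hLstar : ∀ x, star (iL x x) = iL x x)
    (hc : ∀ x y z, iL x y • z = x <• iR y z) (x : X) : ‖iR x x‖ ≤ ‖iL x x‖ := by
  set a := iR x x with ha
  set b := iL x x with hb
  have hsa : IsSelfAdjoint a := hstar x x
  have hsb : IsSelfAdjoint b := hLstar x
  obtain ⟨c, hc'⟩ := CStarAlgebra.nonneg_iff_eq_star_mul_self.1
    (sub_nonneg.2 (CStarAlgebra.star_mul_le_algebraMap_norm_sq (a := b)))
  rw [hsb.star_eq] at hc'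
  have hop : ∀ (r : ℝ) (y : X), (algebraMap ℝ B r) • y = y <• (algebraMap ℝ B r) := by
    intro r y
    rw [IsScalarTower.algebraMap_apply ℝ ℂ B, algebraMap_smul,
      Algebra.algebraMap_eq_smul_one (A := B), MulOpposite.op_smul, smul_assoc,
      MulOpposite.op_one, one_smul]
  have h3 : a * a * a = a * algebraMap ℝ B (‖b‖ ^ 2) - iR (c • x) (c • x) := by
    have e1 : iR (c • x) (c • x) = iR x ((star c * c) • x) := by
      rw [mul_smul, hadj]
    have e2 : iR x ((b * b) • x) = a * a * a := by
      have e3 : b • x = x <• a := hc x x x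
      calc iR x ((b * b) • x) = iR x (b • b • x) := by rw [mul_smul]
        _ = iR (b • x) (b • x) := by rw [hadj, hsb.star_eq]
        _ = iR (x <• a) x * a := by rw [e3, hr]
        _ = a * a * a := by rw [← hstar, hr, ← ha, star_mul, hsa.star_eq]
    rw [e1, ← hc', sub_smul, map_sub, e2, hop, hr, ← ha]
    abel
  have h4 : a * a * a ≤ a * algebraMap ℝ B (‖b‖ ^ 2) := by
    rw [h3]; exact sub_le_self _ (hnn _)
  have h5 : 0 ≤ a * a * a := by
    have := star_left_conjugate_nonneg (hnn x) a
    rwa [hsa.star_eq] at this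
  have h6 : ‖a * a * a‖ ≤ ‖b‖ ^ 2 * ‖a‖ := by
    refine (CStarAlgebra.norm_le_norm_of_nonneg_of_le h5 h4).trans_eq ?_
    rw [← Algebra.commutes, ← Algebra.smul_def, norm_smul, Real.norm_of_nonneg (by positivity)]
  have h7 : ‖a‖ ^ 4 ≤ ‖b‖ ^ 2 * ‖a‖ * ‖a‖ := by
    have h8 : IsSelfAdjoint (a * a) := by
      rw [IsSelfAdjoint, star_mul, hsa.star_eq]
    calc ‖a‖ ^ 4 = ‖a * a * a * a‖ := by
          rw [mul_assoc (a * a), h8.norm_mul_self, hsa.norm_mul_self]; ring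
      _ ≤ _ := (norm_mul_le _ _).trans (by gcongr)
  by_contra! hlt
  have hpos : 0 < ‖a‖ := (norm_nonneg _).trans_lt hlt
  have : ‖b‖ ^ 2 < ‖a‖ ^ 2 := by gcongr
  nlinarith [mul_lt_mul_of_pos_right this (pow_pos hpos 2)]

variable (M N)

/-- The right inner product `⟨s ⊗ t, s' ⊗ t'⟩ = ⟨t, ⟨s, s'⟩ t'⟩` on `M ⊗_B N`. -/
def tensorInnerR : TensorCarrier M N →+ TensorCarrier M N →+ B :=
  tensorLift (mkBiadd
    (fun s t => tensorLift (mkBiadd (fun s' t' => N.innerR t (M.innerR s s' • t'))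
      (fun s' s'' t' => by rw [M.innerR_add_right, add_smul, N.innerR_add_right])
      (fun s' t' t'' => by rw [smul_add, N.innerR_add_right]))
      (fun s' b t' => by simp only [mkBiadd_apply, M.innerR_smul_right, mul_smul]))
    (fun s s' t => tensor_addHom_ext fun m n => by
      change N.innerR t (M.innerR (s + s') m • n) =
        N.innerR t (M.innerR s m • n) + N.innerR t (M.innerR s' m • n)
      rw [M.innerR_add_left, add_smul, N.innerR_add_right])
    (fun s t t' => tensor_addHom_ext fun m n => by
      exact N.innerR_add_left _ _ _))
    (fun s b t => tensor_addHom_ext fun m n => by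
      simp [M.innerR_smul_left, mul_smul, N.innerR_smul_left_adjoint])

/-- The left inner product `⟨s ⊗ t, s' ⊗ t'⟩ = ⟨s ⟨t, t'⟩, s'⟩` on `M ⊗_B N`. -/
def tensorInnerL : TensorCarrier M N →+ TensorCarrier M N →+ B :=
  tensorLift (mkBiadd
    (fun s t => tensorLift (mkBiadd (fun s' t' => M.innerL (s <• N.innerL t t') s')
      (fun s' s'' t' => M.innerL_add_right _ _ _)
      (fun s' t' t'' => by
        rw [N.innerL_add_right, MulOpposite.op_add, add_smul, M.innerL_add_left]))
      (fun s' b t' => by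
        simp only [mkBiadd_apply, N.innerL_smul_right, MulOpposite.op_mul, mul_smul]
        rw [M.innerL_smul_right_adjoint (star b), star_star]))
    (fun s s' t => tensor_addHom_ext fun m n => by
      simp only [AddMonoidHom.add_apply, tensorLift_tmul, mkBiadd_apply, smul_add,
        M.innerL_add_left])
    (fun s t t' => tensor_addHom_ext fun m n => by
      simp only [AddMonoidHom.add_apply, tensorLift_tmul, mkBiadd_apply, N.innerL_add_left,
        MulOpposite.op_add, add_smul, M.innerL_add_left]))
    (fun s b t => tensor_addHom_ext fun m n => by
      simp [N.innerL_smul_left, mul_smul])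

variable {M N}

@[simp] lemma tensorInnerR_tmul (s s' : M) (t t' : N) :
    tensorInnerR M N (tmul s t) (tmul s' t') = N.innerR t (M.innerR s s' • t') := rfl

@[simp] lemma tensorInnerL_tmul (s s' : M) (t t' : N) :
    tensorInnerL M N (tmul s t) (tmul s' t') = M.innerL (s <• N.innerL t t') s' := rfl

/-- Two-variable induction for additive statements on `M ⊗_B N`. -/
lemma tensor_induction₂ {p : TensorCarrier M N → TensorCarrier M N → Prop}
    (x y : TensorCarrier M N) (zl : ∀ y, p 0 y) (zr : ∀ x, p x 0)
    (h : ∀ s t s' t', p (tmul s t) (tmul s' t'))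
    (al : ∀ x x' y, p x y → p x' y → p (x + x') y)
    (ar : ∀ x y y', p x y → p x y' → p x (y + y')) : p x y := by
  induction x using tensor_induction with
  | zero => exact zl y
  | add x x' hx hx' => exact al _ _ _ hx hx'
  | tmul s t =>
    induction y using tensor_induction with
    | zero => exact zr _
    | add y y' hy hy' => exact ar _ _ _ hy hy'
    | tmul s' t' => exact h s t s' t'

lemma star_tensorInnerR (x y : TensorCarrier M N) :
    star (tensorInnerR M N x y) = tensorInnerR M N y x := by
  induction x, y using tensor_induction₂ with
  | zl | zr => simp
  | al x x' y h h' => simp [h, h']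
  | ar x x' y h h' => simp [h, h']
  | h s t s' t' =>
    rw [tensorInnerR_tmul, tensorInnerR_tmul, N.star_innerR, N.innerR_smul_left_adjoint,
      M.star_innerR]

lemma star_tensorInnerL (x y : TensorCarrier M N) :
    star (tensorInnerL M N x y) = tensorInnerL M N y x := by
  induction x, y using tensor_induction₂ with
  | zl | zr => simp
  | al x x' y h h' => simp [h, h']
  | ar x x' y h h' => simp [h, h']
  | h s t s' t' =>
    rw [tensorInnerL_tmul, tensorInnerL_tmul, M.star_innerL, M.innerL_smul_right_adjoint,
      N.star_innerL]

lemma tensorInnerR_smul (b : B) (x y : TensorCarrier M N) :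
    tensorInnerR M N x (y <• b) = tensorInnerR M N x y * b := by
  induction x, y using tensor_induction₂ with
  | zl | zr => simp
  | al x x' y h h' => simp [h, h', add_mul]
  | ar x x' y h h' => simp [h, h', add_mul]
  | h s t s' t' =>
    rw [tmul_smul_right, tensorInnerR_tmul, tensorInnerR_tmul, smul_comm, N.innerR_smul_right]

lemma tensorInnerL_smul (b : B) (x y : TensorCarrier M N) :
    tensorInnerL M N (b • x) y = b * tensorInnerL M N x y := by
  induction x, y using tensor_induction₂ with
  | zl | zr => simp
  | al x x' y h h' => simp [h, h', mul_add]
  | ar x x' y h h' => simp [h, h', mul_add]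
  | h s t s' t' =>
    rw [smul_tmul_left, tensorInnerL_tmul, tensorInnerL_tmul, ← smul_comm b, M.innerL_smul_left]

lemma tensorInnerR_adjoint (b : B) (x y : TensorCarrier M N) :
    tensorInnerR M N (b • x) y = tensorInnerR M N x (star b • y) := by
  induction x, y using tensor_induction₂ with
  | zl | zr => simp
  | al x x' y h h' => simp [h, h']
  | ar x x' y h h' => simp [h, h']
  | h s t s' t' =>
    rw [smul_tmul_left, smul_tmul_left, tensorInnerR_tmul, tensorInnerR_tmul,
      M.innerR_smul_left_adjoint]

lemma tensorInnerL_adjoint (b : B) (x y : TensorCarrier M N) :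
    tensorInnerL M N (x <• b) y = tensorInnerL M N x (y <• star b) := by
  induction x, y using tensor_induction₂ with
  | zl | zr => simp
  | al x x' y h h' => simp [h, h']
  | ar x x' y h h' => simp [h, h']
  | h s t s' t' =>
    rw [tmul_smul_right, tmul_smul_right, tensorInnerL_tmul, tensorInnerL_tmul,
      N.innerL_smul_right_adjoint]

lemma tensorInner_compat (x y z : TensorCarrier M N) :
    tensorInnerL M N x y • z = x <• tensorInnerR M N y z := by
  induction x, y using tensor_induction₂ with
  | zl | zr => simp
  | al x x' y h h' => simp [h, h', add_smul]
  | ar x x' y h h' => simp [h, h', add_smul]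
  | h s t s' t' =>
    induction z using tensor_induction with
    | zero => simp
    | add z z' h h' => rw [smul_add, h, h', map_add, MulOpposite.op_add, add_smul]
    | tmul s'' t'' =>
      rw [tensorInnerL_tmul, tensorInnerR_tmul, smul_tmul_left, tmul_smul_right,
        M.innerL_smul_eq, smul_tmul, ← N.innerL_smul_eq]
      exact smul_tmul _ _ _

/-- For `w : M`, the map `s ⊗ t ↦ ⟨w, s⟩ t`. -/
def coordR (w : M) : TensorCarrier M N →+ N :=
  tensorLift (mkBiadd (fun s t => M.innerR w s • t)
    (fun s s' t => by rw [M.innerR_add_right, add_smul]) (fun s t t' => smul_add _ _ _))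
    (fun s b t => by simp only [mkBiadd_apply, M.innerR_smul_right, mul_smul])

/-- For `z : N`, the map `s ⊗ t ↦ s ⟨t, z⟩`. -/
def coordL (z : N) : TensorCarrier M N →+ M :=
  tensorLift (mkBiadd (fun s t => s <• N.innerL t z)
    (fun s s' t => smul_add _ _ _)
    (fun s t t' => by rw [N.innerL_add_left, MulOpposite.op_add, add_smul]))
    (fun s b t => by simp only [mkBiadd_apply, N.innerL_smul_left, MulOpposite.op_mul, mul_smul])

@[simp] lemma coordR_tmul (w s : M) (t : N) : coordR w (tmul s t) = M.innerR w s • t := rfl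
@[simp] lemma coordL_tmul (z : N) (s : M) (t : N) :
    coordL z (tmul s t) = s <• N.innerL t z := rfl

lemma sum_smul_innerR {n : ℕ} {w : Fin n → M} (hw : ∑ i, M.innerL (w i) (w i) = 1) (x : M) :
    ∑ i, w i <• M.innerR (w i) x = x := by
  simp only [← M.innerL_smul_eq, ← Finset.sum_smul, hw, one_smul]

lemma sum_innerL_smul {n : ℕ} {z : Fin n → N} (hz : ∑ i, N.innerR (z i) (z i) = 1) (x : N) :
    ∑ i, N.innerL x (z i) • z i = x := by
  simp only [N.innerL_smul_eq, ← Finset.sum_smul, ← Finset.op_sum, hz, MulOpposite.op_one,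
    one_smul]

lemma tensorInnerR_eq_sum {n : ℕ} {w : Fin n → M} (hw : ∑ i, M.innerL (w i) (w i) = 1)
    (x y : TensorCarrier M N) :
    tensorInnerR M N x y = ∑ i, N.innerR (coordR (w i) x) (coordR (w i) y) := by
  induction x, y using tensor_induction₂ with
  | zl y => simp [← innerRHom_apply]
  | zr x => simp [← innerRHom_apply]
  | al x x' y h h' => simp [h, h', N.innerR_add_left, Finset.sum_add_distrib]
  | ar x x' y h h' => simp [h, h', N.innerR_add_right, Finset.sum_add_distrib]
  | h s t s' t' =>
    simp only [tensorInnerR_tmul, coordR_tmul, N.innerR_smul_left_adjoint, M.star_innerR,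
      ← mul_smul, ← N.innerR_sum_right, ← Finset.sum_smul, ← M.innerR_smul_right,
      ← M.innerR_sum_right, sum_smul_innerR hw]

lemma tensorInnerL_eq_sum {n : ℕ} {z : Fin n → N} (hz : ∑ i, N.innerR (z i) (z i) = 1)
    (x y : TensorCarrier M N) :
    tensorInnerL M N x y = ∑ i, M.innerL (coordL (z i) x) (coordL (z i) y) := by
  induction x, y using tensor_induction₂ with
  | zl y => simp [← innerLHom_apply]
  | zr x => simp [← innerLHom_apply]
  | al x x' y h h' => simp [h, h', M.innerL_add_left, Finset.sum_add_distrib]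
  | ar x x' y h h' => simp [h, h', M.innerL_add_right, Finset.sum_add_distrib]
  | h s t s' t' =>
    have key : ∀ i, M.innerL (s <• N.innerL t (z i)) (s' <• N.innerL t' (z i)) =
        M.innerL (s <• N.innerL (N.innerL t (z i) • z i) t') s' := fun i => by
      rw [N.innerL_smul_left, MulOpposite.op_mul, mul_smul,
        M.innerL_smul_right_adjoint (N.innerL (z i) t'), N.star_innerL]
    simp only [tensorInnerL_tmul, coordL_tmul, key, ← M.innerL_sum_left, ← Finset.sum_smul,
      ← Finset.op_sum, ← N.innerL_sum_left, sum_innerL_smul hz]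

lemma sum_tmul_coordL {n : ℕ} {z : Fin n → N} (hz : ∑ i, N.innerR (z i) (z i) = 1)
    (x : TensorCarrier M N) : ∑ i, tmul (coordL (z i) x) (z i) = x := by
  induction x using tensor_induction with
  | zero => simp [zero_tmul]
  | add x y hx hy => simp only [map_add, add_tmul, Finset.sum_add_distrib, hx, hy]
  | tmul s t =>
    have h : ∀ f : Fin n → N, ∑ i, tmul s (f i) = tmul s (∑ i, f i) := fun f =>
      (map_sum (AddMonoidHom.mk' (tmul s) (tmul_add s)) f Finset.univ).symm
    simp only [coordL_tmul, smul_tmul, h, sum_innerL_smul hz]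

lemma tensorInnerR_self_nonneg (x : TensorCarrier M N) : 0 ≤ tensorInnerR M N x x := by
  obtain ⟨n, w, hw⟩ := M.exists_frame_left
  rw [tensorInnerR_eq_sum hw]
  exact Finset.sum_nonneg fun i _ => N.innerR_self_nonneg _

lemma innerL_coordL_le {n : ℕ} {z : Fin n → N} (hz : ∑ i, N.innerR (z i) (z i) = 1)
    (x : TensorCarrier M N) (i : Fin n) :
    M.innerL (coordL (z i) x) (coordL (z i) x) ≤ tensorInnerL M N x x := by
  rw [tensorInnerL_eq_sum hz]
  exact Finset.single_le_sum (f := fun i => M.innerL (coordL (z i) x) (coordL (z i) x))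
    (fun i _ => M.innerL_self_nonneg _) (Finset.mem_univ i)

lemma tensorInnerL_self_nonneg (x : TensorCarrier M N) : 0 ≤ tensorInnerL M N x x := by
  obtain ⟨n, z, hz⟩ := N.exists_frame_right
  rw [tensorInnerL_eq_sum hz]
  exact Finset.sum_nonneg fun i _ => M.innerL_self_nonneg _

lemma norm_coordL_sq_le {n : ℕ} {z : Fin n → N} (hz : ∑ i, N.innerR (z i) (z i) = 1)
    (x : TensorCarrier M N) (i : Fin n) : ‖coordL (z i) x‖ ^ 2 ≤ ‖tensorInnerL M N x x‖ := by
  rw [M.norm_sq_eq_innerL]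
  exact CStarAlgebra.norm_le_norm_of_nonneg_of_le (M.innerL_self_nonneg _)
    (innerL_coordL_le hz x i)

lemma eq_zero_of_tensorInnerL {x : TensorCarrier M N} (h : tensorInnerL M N x x = 0) : x = 0 := by
  obtain ⟨n, z, hz⟩ := N.exists_frame_right
  rw [← sum_tmul_coordL hz x]
  refine Finset.sum_eq_zero fun i _ => ?_
  have h0 := norm_coordL_sq_le hz x i
  rw [h, norm_zero] at h0
  have : coordL (z i) x = 0 := by
    rw [← norm_eq_zero, ← sq_eq_zero_iff]
    exact le_antisymm h0 (by positivity)
  rw [this, zero_tmul]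

instance : Norm (TensorCarrier M N) := ⟨fun x => √‖tensorInnerL M N x x‖⟩

lemma tensor_norm_sq (x : TensorCarrier M N) : ‖x‖ ^ 2 = ‖tensorInnerL M N x x‖ :=
  Real.sq_sqrt (norm_nonneg _)

lemma tensorInnerL_complex_smul (c : ℂ) (x y : TensorCarrier M N) :
    tensorInnerL M N (c • x) y = c • tensorInnerL M N x y := by
  rw [← algebraMap_smul B c x, tensorInnerL_smul, Algebra.algebraMap_eq_smul_one, smul_one_mul]

instance : CStarModule B (TensorCarrier M N) where
  inner x y := tensorInnerL M N y x
  inner_add_right := by simp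
  inner_self_nonneg := tensorInnerL_self_nonneg _
  inner_self := ⟨eq_zero_of_tensorInnerL, by rintro rfl; simp⟩
  inner_op_smul_right := tensorInnerL_smul _ _ _
  inner_smul_right_complex := tensorInnerL_complex_smul _ _ _
  star_inner x y := star_tensorInnerL _ _
  norm_eq_sqrt_norm_inner_self _ := rfl

instance : NormedAddCommGroup (TensorCarrier M N) :=
  NormedAddCommGroup.ofCore (CStarModule.normedSpaceCore B (E := TensorCarrier M N))

instance : NormedSpace ℂ (TensorCarrier M N) :=
  NormedSpace.ofCore (CStarModule.normedSpaceCore B (E := TensorCarrier M N))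

lemma tensorInner_norm_eq (x : TensorCarrier M N) :
    ‖tensorInnerL M N x x‖ = ‖tensorInnerR M N x x‖ :=
  le_antisymm
    (norm_innerL_le_aux _ _ tensorInnerL_smul star_tensorInnerL tensorInnerL_self_nonneg
      tensorInnerL_adjoint (fun x => star_tensorInnerR x x) tensorInner_compat x)
    (norm_innerR_le_aux _ _ tensorInnerR_smul star_tensorInnerR tensorInnerR_self_nonneg
      tensorInnerR_adjoint (fun x => star_tensorInnerL x x) tensorInner_compat x)

lemma norm_tmul_le (x : M) (y : N) : ‖tmul x y‖ ≤ ‖x‖ * ‖y‖ := by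
  refine (pow_le_pow_iff_left₀ (norm_nonneg _) (by positivity) two_ne_zero).1 ?_
  rw [tensor_norm_sq, tensorInner_norm_eq, tensorInnerR_tmul]
  obtain ⟨c, hc⟩ := CStarAlgebra.nonneg_iff_eq_star_mul_self.1 (M.innerR_self_nonneg x)
  have h1 : N.innerR y (M.innerR x x • y) = N.innerR (c • y) (c • y) := by
    rw [hc, mul_smul, N.innerR_smul_left_adjoint]
  have h2 : ‖c • y‖ ≤ ‖c‖ * ‖y‖ := N.norm_smul_le_aux c y
  have h3 : ‖x‖ = ‖c‖ := by
    rw [← sq_eq_sq₀ (norm_nonneg _) (norm_nonneg _), M.norm_sq_eq_innerR, hc,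
      CStarRing.norm_star_mul_self, sq]
  rw [h1, ← N.norm_sq_eq_innerR, h3]
  gcongr

instance : CompleteSpace (TensorCarrier M N) := by
  obtain ⟨n, z, hz⟩ := N.exists_frame_right
  refine Metric.complete_of_cauchySeq_tendsto fun u hu => ?_
  have hcont : ∀ y : N, Continuous fun x : M => tmul x y := fun y =>
    AddMonoidHomClass.continuous_of_bound
      (AddMonoidHom.mk' (fun x : M => tmul x y) fun a b => add_tmul a b y) ‖y‖
      fun x => (norm_tmul_le x y).trans_eq (mul_comm _ _)
  have hlip : ∀ i, LipschitzWith 1 (coordL (M := M) (z i)) := fun i =>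
    AddMonoidHomClass.lipschitz_of_bound_nnnorm _ 1 fun x => by
      rw [one_mul, ← NNReal.coe_le_coe, coe_nnnorm, coe_nnnorm]
      refine (pow_le_pow_iff_left₀ (norm_nonneg _) (norm_nonneg _) two_ne_zero).1 ?_
      rw [tensor_norm_sq]
      exact norm_coordL_sq_le hz x i
  have hlim : ∀ i, ∃ y, Filter.Tendsto (fun k => coordL (z i) (u k)) Filter.atTop (nhds y) :=
    fun i => cauchySeq_tendsto_of_complete (hu.map (hlip i).uniformContinuous)
  choose y hy using hlim
  refine ⟨∑ i, tmul (y i) (z i), ?_⟩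
  have h := tendsto_finsetSum Finset.univ fun i _ =>
    ((hcont (z i)).tendsto (y i)).comp (hy i)
  refine h.congr fun k => ?_
  exact sum_tmul_coordL hz (u k)

lemma dense_aux {P : MoritaBimodule B} {S : Set B} (h : ∀ x y, P.innerR x y ∈ Submodule.span ℂ S) :
    Dense (Submodule.span ℂ S : Set B) :=
  P.fullR.mono (Submodule.span_le.2 (by rintro _ ⟨x, y, rfl⟩; exact h x y))

lemma dense_aux' {P : MoritaBimodule B} {S : Set B}
    (h : ∀ x y, P.innerL x y ∈ Submodule.span ℂ S) :
    Dense (Submodule.span ℂ S : Set B) :=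
  P.fullL.mono (Submodule.span_le.2 (by rintro _ ⟨x, y, rfl⟩; exact h x y))

variable (M N)

/-- The internal tensor product `M ⊗_B N` of Morita equivalence `B`-bimodules, with
`⟨s ⊗ t, s' ⊗ t'⟩_R = ⟨t, ⟨s, s'⟩_R t'⟩_R` and `⟨s ⊗ t, s' ⊗ t'⟩_L = ⟨s ⟨t, t'⟩_L, s'⟩_L`. Since `B`
is unital, these inner products are definite and complete on the algebraic balanced tensor product,
so that no further quotient or completion is needed. -/
def tensor : MoritaBimodule B where
  carrier := TensorCarrier M N
  innerL x y := tensorInnerL M N x y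
  innerR x y := tensorInnerR M N x y
  innerL_add_left x y z := by simp
  innerL_smul_left := tensorInnerL_smul
  star_innerL := star_tensorInnerL
  innerL_self_nonneg := tensorInnerL_self_nonneg
  norm_sq_eq_innerL := tensor_norm_sq
  fullL := by
    obtain ⟨n, z, hz⟩ := N.exists_frame_left
    refine dense_aux' (P := M) fun x y => ?_
    have : M.innerL x y = ∑ i, tensorInnerL M N (tmul x (z i)) (tmul y (z i)) := by
      simp only [tensorInnerL_tmul, ← M.innerL_sum_left, ← Finset.sum_smul, ← Finset.op_sum,
        hz, MulOpposite.op_one, one_smul]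
    rw [this]
    exact sum_mem fun i _ => Submodule.subset_span ⟨_, _, rfl⟩
  innerR_add_right x y z := by simp
  innerR_smul_right := tensorInnerR_smul
  star_innerR := star_tensorInnerR
  innerR_self_nonneg := tensorInnerR_self_nonneg
  norm_sq_eq_innerR x := (tensor_norm_sq x).trans (tensorInner_norm_eq x)
  fullR := by
    obtain ⟨n, w, hw⟩ := M.exists_frame_right
    refine dense_aux (P := N) fun x y => ?_
    have : N.innerR x y = ∑ i, tensorInnerR M N (tmul (w i) x) (tmul (w i) y) := by
      simp only [tensorInnerR_tmul, ← N.innerR_sum_right, ← Finset.sum_smul, hw, one_smul]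
    rw [this]
    exact sum_mem fun i _ => Submodule.subset_span ⟨_, _, rfl⟩
  innerR_smul_left_adjoint := tensorInnerR_adjoint
  innerL_smul_right_adjoint := tensorInnerL_adjoint
  innerL_smul_eq := tensorInner_compat

end tensor


/-- A Morita equivalence bimodule isomorphism: a `B`-bimodule isomorphism that preserves both inner
products. -/
structure Iso (M N : MoritaBimodule B) extends M ≃ₗ[ℂ] N where
  map_smul_left : ∀ (b : B) (x : M), toFun (b • x) = b • toFun x
  map_smul_right : ∀ (b : B) (x : M), toFun (x <• b) = toFun x <• b
  map_innerL : ∀ x y : M, N.innerL (toFun x) (toFun y) = M.innerL x y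
  map_innerR : ∀ x y : M, N.innerR (toFun x) (toFun y) = M.innerR x y

namespace Iso

variable {M N P M' N' : MoritaBimodule B}

instance : CoeFun (Iso M N) (fun _ => M → N) := ⟨fun f => f.toLinearEquiv⟩

lemma smul_left (f : Iso M N) (b : B) (x : M) : f (b • x) = b • f x := f.map_smul_left b x
lemma smul_right (f : Iso M N) (b : B) (x : M) : f (x <• b) = f x <• b := f.map_smul_right b x
lemma innerL_map (f : Iso M N) (x y : M) : N.innerL (f x) (f y) = M.innerL x y := f.map_innerL x y
lemma innerR_map (f : Iso M N) (x y : M) : N.innerR (f x) (f y) = M.innerR x y := f.map_innerR x y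

/-- The identity isomorphism. -/
def refl (M : MoritaBimodule B) : Iso M M where
  toLinearEquiv := LinearEquiv.refl ℂ M
  map_smul_left _ _ := rfl
  map_smul_right _ _ := rfl
  map_innerL _ _ := rfl
  map_innerR _ _ := rfl

/-- The inverse isomorphism. -/
def symm (f : Iso M N) : Iso N M where
  toLinearEquiv := f.toLinearEquiv.symm
  map_smul_left b x := f.toLinearEquiv.symm_apply_eq.2 <| by
    rw [f.smul_left]; exact congrArg (b • ·) (f.toLinearEquiv.apply_symm_apply x).symm
  map_smul_right b x := f.toLinearEquiv.symm_apply_eq.2 <| by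
    rw [f.smul_right]; exact congrArg (· <• b) (f.toLinearEquiv.apply_symm_apply x).symm
  map_innerL x y := by
    obtain ⟨x, rfl⟩ := f.toLinearEquiv.surjective x
    obtain ⟨y, rfl⟩ := f.toLinearEquiv.surjective y
    rw [f.innerL_map]
    exact congrArg₂ M.innerL (f.toLinearEquiv.symm_apply_apply x)
      (f.toLinearEquiv.symm_apply_apply y)
  map_innerR x y := by
    obtain ⟨x, rfl⟩ := f.toLinearEquiv.surjective x
    obtain ⟨y, rfl⟩ := f.toLinearEquiv.surjective y
    rw [f.innerR_map]
    exact congrArg₂ M.innerR (f.toLinearEquiv.symm_apply_apply x)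
      (f.toLinearEquiv.symm_apply_apply y)

/-- Composition of isomorphisms. -/
def trans (f : Iso M N) (g : Iso N P) : Iso M P where
  toLinearEquiv := f.toLinearEquiv.trans g.toLinearEquiv
  map_smul_left b x := (congrArg g (f.smul_left b x)).trans (g.smul_left _ _)
  map_smul_right b x := (congrArg g (f.smul_right b x)).trans (g.smul_right _ _)
  map_innerL _ _ := (g.innerL_map _ _).trans (f.innerL_map _ _)
  map_innerR _ _ := (g.innerR_map _ _).trans (f.innerR_map _ _)

/-- A surjective additive `B`-bimodule map preserving both inner products is an isomorphism. -/
def ofAddHom (f : M →+ N) (hl : ∀ (b : B) x, f (b • x) = b • f x)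
    (hr : ∀ (b : B) x, f (x <• b) = f x <• b)
    (hL : ∀ x y, N.innerL (f x) (f y) = M.innerL x y)
    (hR : ∀ x y, N.innerR (f x) (f y) = M.innerR x y) (hs : Function.Surjective f) : Iso M N where
  toLinearEquiv := LinearEquiv.ofBijective
    { toFun := f
      map_add' := map_add f
      map_smul' := fun c x => by
        simpa only [algebraMap_smul, RingHom.id_apply] using hl (algebraMap ℂ B c) x }
    ⟨(injective_iff_map_eq_zero f).2 fun x hx => by
      rw [← norm_eq_zero, ← sq_eq_zero_iff, M.norm_sq_eq_innerR, ← hR, ← N.norm_sq_eq_innerR, hx,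
        norm_zero, sq, zero_mul], hs⟩
  map_smul_left := hl
  map_smul_right := hr
  map_innerL := hL
  map_innerR := hR

/-- An isomorphism out of a tensor product from a balanced biadditive map. -/
def ofBalanced (f : M →+ N →+ P) (hf : ∀ m (b : B) n, f (m <• b) n = f m (b • n))
    (hl : ∀ (b : B) m n, f (b • m) n = b • f m n) (hr : ∀ (b : B) m n, f m (n <• b) = f m n <• b)
    (hL : ∀ m n m' n', P.innerL (f m n) (f m' n') = M.innerL (m <• N.innerL n n') m')
    (hR : ∀ m n m' n', P.innerR (f m n) (f m' n') = N.innerR n (M.innerR m m' • n'))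
    (hs : ∀ p, p ∈ AddSubgroup.closure {p : P | ∃ m n, f m n = p}) : Iso (M.tensor N) P :=
  ofAddHom (M := M.tensor N) (tensorLift f hf)
    (fun b (x : TensorCarrier M N) => by
      change tensorLift f hf (b • x) = b • tensorLift f hf x
      induction x using tensor_induction with
      | zero => simp
      | add x y hx hy => simp only [smul_add, map_add, hx, hy]
      | tmul m n => exact hl b m n)
    (fun b (x : TensorCarrier M N) => by
      change tensorLift f hf (x <• b) = tensorLift f hf x <• b
      induction x using tensor_induction with
      | zero => simp
      | add x y hx hy => simp only [smul_add, map_add, hx, hy]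
      | tmul m n => exact hr b m n)
    (fun x y => by
      change TensorCarrier M N at x y
      change P.innerL (tensorLift f hf x) (tensorLift f hf y) = tensorInnerL M N x y
      induction x, y using tensor_induction₂ with
      | zl | zr => simp [← innerLHom_apply]
      | al x x' y h h' => simp [h, h', P.innerL_add_left]
      | ar x x' y h h' => simp [h, h', P.innerL_add_right]
      | h s t s' t' => exact hL s t s' t')
    (fun x y => by
      change TensorCarrier M N at x y
      change P.innerR (tensorLift f hf x) (tensorLift f hf y) = tensorInnerR M N x y
      induction x, y using tensor_induction₂ with
      | zl | zr => simp [← innerRHom_apply]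
      | al x x' y h h' => simp [h, h', P.innerR_add_left]
      | ar x x' y h h' => simp [h, h', P.innerR_add_right]
      | h s t s' t' => exact hR s t s' t')
    (fun p => by
      have h : p ∈ (tensorLift f hf).range := by
        refine (AddSubgroup.closure_le _).2 ?_ (hs p)
        rintro _ ⟨m, n, rfl⟩
        exact ⟨tmul m n, rfl⟩
      exact h)

lemma closure_tmul (x : TensorCarrier M N) :
    x ∈ AddSubgroup.closure {x : TensorCarrier M N | ∃ m n, tmul m n = x} := by
  induction x using tensor_induction with
  | zero => exact zero_mem _
  | add x y hx hy => exact add_mem hx hy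
  | tmul m n => exact AddSubgroup.subset_closure ⟨m, n, rfl⟩

/-- The tensor product of two isomorphisms. -/
def tensorCongr (f : Iso M M') (g : Iso N N') : Iso (M.tensor N) (M'.tensor N') :=
  ofBalanced (P := M'.tensor N')
    (mkBiadd (fun m n => (tmul (f m) (g n) : TensorCarrier M' N'))
      (fun m m' n => (congrArg (tmul · (g n)) (map_add f.toLinearEquiv m m')).trans
        (add_tmul _ _ _))
      (fun m n n' => (congrArg (tmul (f m) ·) (map_add g.toLinearEquiv n n')).trans
        (tmul_add _ _ _)))
    (fun m b n => by
      change tmul (f (m <• b)) (g n) = tmul (f m) (g (b • n))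
      rw [f.smul_right, g.smul_left]
      exact smul_tmul _ _ _)
    (fun b m n => congrArg (tmul · (g n)) (f.smul_left b m))
    (fun b m n => congrArg (tmul (f m) ·) (g.smul_right b n))
    (fun m n m' n' => by
      change M'.innerL (f m <• N'.innerL (g n) (g n')) (f m') = _
      rw [g.innerL_map, ← f.smul_right, f.innerL_map])
    (fun m n m' n' => by
      change N'.innerR (g n) (M'.innerR (f m) (f m') • g n') = _
      rw [f.innerR_map, ← g.smul_left, g.innerR_map])
    (fun p => by
      refine AddSubgroup.closure_mono ?_ (closure_tmul (M := M') (N := N') p)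
      rintro _ ⟨m, n, rfl⟩
      exact ⟨f.symm m, g.symm n, congrArg₂ tmul (f.toLinearEquiv.apply_symm_apply m)
        (g.toLinearEquiv.apply_symm_apply n)⟩)


/-- The biadditive map `(s ⊗ t, u) ↦ s ⊗ (t ⊗ u)`. -/
def assocHom (M N P : MoritaBimodule B) : TensorCarrier M N →+ P →+ M.tensor (N.tensor P) :=
  tensorLift (mkBiadd (fun m n => AddMonoidHom.mk'
    (fun p => (tmul m (tmul n p : N.tensor P) : M.tensor (N.tensor P)))
      (fun p p' => (congrArg (tmul m ·) (tmul_add n p p')).trans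
        (tmul_add (N := N.tensor P) _ _ _)))
    (fun m m' n => by ext p; exact add_tmul (N := N.tensor P) m m' (tmul n p))
    (fun m n n' => by
      ext p
      exact (congrArg (tmul m ·) (add_tmul n n' p)).trans
        (tmul_add (N := N.tensor P) _ _ _)))
    (fun m b n => by ext p; exact smul_tmul (N := N.tensor P) m b (tmul n p))

/-- The associativity isomorphism `(s ⊗ t) ⊗ u ↦ s ⊗ (t ⊗ u)`. -/
def assoc (M N P : MoritaBimodule B) :
    Iso ((M.tensor N).tensor P) (M.tensor (N.tensor P)) :=
  ofBalanced (M := M.tensor N) (P := M.tensor (N.tensor P)) (assocHom M N P)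
    (fun (x : TensorCarrier M N) b p => by
      change assocHom M N P (x <• b) p = assocHom M N P x (b • p)
      induction x using tensor_induction with
      | zero => simp
      | add x y hx hy => simp [hx, hy]
      | tmul m n => exact congrArg (tmul (N := N.tensor P) m ·) (smul_tmul n b p))
    (fun b (x : TensorCarrier M N) p => by
      change assocHom M N P (b • x) p = b • assocHom M N P x p
      induction x using tensor_induction with
      | zero => simp
      | add x y hx hy => simp [hx, hy]
      | tmul m n => rfl)
    (fun b (x : TensorCarrier M N) p => by
      change assocHom M N P x (p <• b) = assocHom M N P x p <• b
      induction x using tensor_induction with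
      | zero => simp
      | add x y hx hy => simp [hx, hy]
      | tmul m n => rfl)
    (fun (x : TensorCarrier M N) p (y : TensorCarrier M N) p' => by
      change (M.tensor (N.tensor P)).innerLHom (assocHom M N P x p) (assocHom M N P y p') =
        tensorInnerL M N (x <• P.innerL p p') y
      induction x, y using tensor_induction₂ with
      | zl | zr => simp only [map_zero, AddMonoidHom.zero_apply, smul_zero]
      | al x x' y h h' => simp only [map_add, AddMonoidHom.add_apply, smul_add, h, h']
      | ar x x' y h h' => simp only [map_add, AddMonoidHom.add_apply, h, h']
      | h s t s' t' => rfl)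
    (fun (x : TensorCarrier M N) p (y : TensorCarrier M N) p' => by
      change (M.tensor (N.tensor P)).innerRHom (assocHom M N P x p) (assocHom M N P y p') =
        P.innerRHom p (tensorInnerR M N x y • p')
      induction x, y using tensor_induction₂ with
      | zl | zr => simp only [map_zero, AddMonoidHom.zero_apply, zero_smul]
      | al x x' y h h' => simp only [map_add, AddMonoidHom.add_apply, add_smul, h, h']
      | ar x x' y h h' => simp only [map_add, AddMonoidHom.add_apply, add_smul, h, h']
      | h s t s' t' => rfl)
    (fun p => by
      change TensorCarrier M (N.tensor P) at p
      induction p using tensor_induction with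
      | zero => exact zero_mem _
      | add x y hx hy => exact add_mem hx hy
      | tmul m x =>
        change TensorCarrier N P at x
        induction x using tensor_induction with
        | zero => exact (tmul_zero (N := N.tensor P) m).symm ▸ zero_mem _
        | add x y hx hy => exact (tmul_add (N := N.tensor P) m x y).symm ▸ add_mem hx hy
        | tmul n p => exact AddSubgroup.subset_closure ⟨tmul m n, p, rfl⟩)

/-- The isomorphism `B ⊗_B M ≅ M`, `b ⊗ x ↦ b • x`. -/
def oneTensor (M : MoritaBimodule B) : Iso ((self B).tensor M) M :=
  ofBalanced (M := self B)
    (show B →+ M →+ M from mkBiadd (fun b x => b • x) (fun b b' x => add_smul b b' x)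
      (fun b x x' => smul_add b x x'))
    (fun (m : B) b n => mul_smul m b n)
    (fun b (m : B) n => mul_smul b m n)
    (fun b (m : B) n => smul_comm m (MulOpposite.op b) n)
    (fun (m : B) n (m' : B) n' => by
      change M.innerL (m • n) (m' • n') = (m * M.innerL n n') * star m'
      rw [M.innerL_smul_left, M.innerL_smul_right, mul_assoc])
    (fun (m : B) n (m' : B) n' => by
      change M.innerR (m • n) (m' • n') = M.innerR n ((star m * m') • n')
      rw [M.innerR_smul_left_adjoint, mul_smul])
    (fun p => AddSubgroup.subset_closure ⟨(1 : B), p, one_smul B p⟩)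

/-- The isomorphism `M̃ ⊗_B M ≅ B`, `x̃ ⊗ y ↦ innerR x y`. -/
def conjTensor (M : MoritaBimodule B) : Iso (M.conj.tensor M) (self B) :=
  ofBalanced (M := M.conj) (P := self B)
    (show M.conj →+ M →+ B from M.innerRHom.comp M.toConj.symm.toAddMonoidHom)
    (fun m b n => (M.innerR_smul_left_adjoint (star b) (M.toConj.symm m) n).trans
      (congrArg (fun c => M.innerR (M.toConj.symm m) (c • n)) (star_star b)))
    (fun b m n => (M.innerR_smul_left (star b) (M.toConj.symm m) n).trans
      (congrArg (· * M.innerR (M.toConj.symm m) n) (star_star b)))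
    (fun b m n => M.innerR_smul_right b (M.toConj.symm m) n)
    (fun m n m' n' => M.conjTensor_aux_left (M.toConj.symm m) n (M.toConj.symm m') n')
    (fun m n m' n' => M.conjTensor_aux_right (M.toConj.symm m) n (M.toConj.symm m') n')
    (fun (p : B) => by
      obtain ⟨n, w, hw⟩ := M.exists_frame_right
      have : p = ∑ i, M.innerR (w i) (w i <• p) := by
        simp only [M.innerR_smul_right, ← Finset.sum_mul, hw, one_mul]
      rw [this]
      exact sum_mem fun i _ => AddSubgroup.subset_closure ⟨M.toConj (w i), w i <• p, rfl⟩)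

/-- An isomorphism induces an isomorphism of conjugate bimodules. -/
def conjCongr {M N : MoritaBimodule B} (f : Iso M N) : Iso M.conj N.conj :=
  ofAddHom (M := M.conj) (N := N.conj)
    (show M.conj →+ N.conj from (f.toLinearEquiv.toLinearMap.toAddMonoidHom : M →+ N))
    (fun b x => f.smul_right (star b) x) (fun b x => f.smul_left (star b) x)
    (fun x y => f.innerR_map x y) (fun x y => f.innerL_map x y)
    (fun x => f.toLinearEquiv.surjective x)

end Iso

/-- Equivalence of Morita equivalence bimodules. -/
instance setoid (B : Type u) [CStarAlgebra B] [PartialOrder B] [StarOrderedRing B] :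
    Setoid (MoritaBimodule B) where
  r M N := Nonempty (Iso M N)
  iseqv := ⟨fun M => ⟨Iso.refl M⟩, fun ⟨f⟩ => ⟨f.symm⟩, fun ⟨f⟩ ⟨g⟩ => ⟨f.trans g⟩⟩


end MoritaBimodule

open MoritaBimodule

/-- The set of equivalence classes of Morita equivalence `B`-bimodules. -/
def Pic (B : Type u) [CStarAlgebra B] [PartialOrder B] [StarOrderedRing B] : Type (u + 1) :=
  Quotient (MoritaBimodule.setoid B)

namespace Pic

variable {B : Type u} [CStarAlgebra B] [PartialOrder B] [StarOrderedRing B]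

/-- The class of a Morita equivalence bimodule. -/
def mk (M : MoritaBimodule B) : Pic B := Quotient.mk _ M

instance : Mul (Pic B) :=
  ⟨Quotient.map₂ tensor fun _ _ ⟨f⟩ _ _ ⟨g⟩ => ⟨Iso.tensorCongr f g⟩⟩

instance : One (Pic B) := ⟨mk (self B)⟩

/-- The class of the conjugate bimodule. -/
instance : Inv (Pic B) := ⟨Quotient.map conj fun _ _ ⟨f⟩ => ⟨Iso.conjCongr f⟩⟩

/-- The Picard group: multiplication is the internal tensor product, the unit is the class of `B`,
and the inverse is given by the conjugate bimodule. -/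
instance : Group (Pic B) :=
  Group.ofLeftAxioms
    (by rintro ⟨M⟩ ⟨N⟩ ⟨P⟩; exact Quotient.sound ⟨Iso.assoc M N P⟩)
    (by rintro ⟨M⟩; exact Quotient.sound ⟨Iso.oneTensor M⟩)
    (by rintro ⟨M⟩; exact Quotient.sound ⟨Iso.conjTensor M⟩)

lemma mk_mul_mk (M N : MoritaBimodule B) : mk M * mk N = mk (M.tensor N) := rfl

end Pic

namespace MoritaBimodule

variable {B : Type u} [CStarAlgebra B] [PartialOrder B] [StarOrderedRing B]

/-- `S` is an adjoint of `T` for the right inner products. -/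
def IsAdjoint {M N : MoritaBimodule B} (T : M → N) (S : N → M) : Prop :=
  ∀ x y, N.innerR (T x) y = M.innerR x (S y)

/-- `T` is adjointable as a map of right Hilbert `B`-modules. -/
def IsAdjointable {M N : MoritaBimodule B} (T : M → N) : Prop :=
  ∃ S : N → M, IsAdjoint T S

/-- Adjoints are unique. -/
lemma IsAdjoint.unique {M N : MoritaBimodule B} {T : M → N} {S S' : N → M}
    (h : IsAdjoint T S) (h' : IsAdjoint T S') : S = S' := by
  funext y
  have h0 : M.innerR (S y - S' y) (S y - S' y) = 0 := by
    rw [← innerRHom_apply, map_sub (M.innerRHom (S y - S' y)), innerRHom_apply, innerRHom_apply,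
      ← h, ← h', sub_self]
  rw [← sub_eq_zero, ← norm_eq_zero, ← sq_eq_zero_iff, M.norm_sq_eq_innerR, h0, norm_zero]

open Classical in
/-- The adjoint `T⋆` of an adjointable map `T` (and `0` if `T` is not adjointable). -/
def adjoint {M N : MoritaBimodule B} (T : M → N) : N → M :=
  if h : IsAdjointable T then h.choose else 0

end MoritaBimodule

/-- A factor system `(B_g, Ψ_{g,h})` for `ψ : G → Pic B`. The identifications `B_e = B` and
`Ψ_{e,e} = id_B` are expressed through an isomorphism `unitIso` of Morita equivalence bimodules
from `B` onto `B_e`. Equations between elements of `B_g` and `B_h`, where `g = h` holds in `G`,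
are stated in the disjoint union `Σ g, B_g`. -/
structure FactorSystem {G : Type*} [Group G] {B : Type u} [CStarAlgebra B] [PartialOrder B]
    [StarOrderedRing B] (ψ : G →* Pic B) where
  /-- the bimodules `B_g` -/
  fiber : G → MoritaBimodule B
  mk_fiber : ∀ g, Pic.mk (fiber g) = ψ g
  /-- the identification of `B` with `B_e` -/
  unitIso : Iso (self B) (fiber 1)
  /-- the isomorphisms `Ψ_{g,h} : B_g ⊗_B B_h → B_{gh}` -/
  mulIso : ∀ g h, Iso ((fiber g).tensor (fiber h)) (fiber (g * h))
  mulIso_one_one : ∀ a b : B,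
    (⟨1 * 1, mulIso 1 1 (tmul (unitIso a) (unitIso b))⟩ : Σ g, fiber g) = ⟨1, unitIso (a * b)⟩
  assoc : ∀ (g h k : G) (s : fiber g) (t : fiber h) (u : fiber k),
    (⟨g * h * k, mulIso (g * h) k (tmul (mulIso g h (tmul s t)) u)⟩ : Σ g, fiber g) =
      ⟨g * (h * k), mulIso g (h * k) (tmul s (mulIso h k (tmul t u)))⟩

namespace FactorSystem

variable {G : Type*} [Group G] {B : Type u} [CStarAlgebra B] [PartialOrder B] [StarOrderedRing B]
  {ψ : G →* Pic B} (F : FactorSystem ψ)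

/-- The multiplication `B_g × B_h → B_{gh}`, `m(s, t) = Ψ_{g,h}(s ⊗ t)`. -/
def mul (g h : G) (s : F.fiber g) (t : F.fiber h) : F.fiber (g * h) :=
  F.mulIso g h (tmul s t)

/-- The identification of `B` with the unit fiber. -/
def unitEquiv : B ≃ₗ[ℂ] F.fiber 1 := F.unitIso.toLinearEquiv

/-- The map `λ_s : B_{g⁻¹} → B_{g g⁻¹} = B_e = B`, `λ_s(t) = Ψ_{g,g⁻¹}(s ⊗ t)`. -/
def leftMul (g : G) (s : F.fiber g) : F.fiber g⁻¹ → self B :=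
  fun t => F.unitEquiv.symm ((mul_inv_cancel g) ▸ F.mul g g⁻¹ s t)

/-- The involution `B_g → B_{g⁻¹}`, `s⋆ = λ_s⋆(1)`. -/
def inv (g : G) (s : F.fiber g) : F.fiber g⁻¹ :=
  adjoint (F.leftMul g s) (1 : B)

end FactorSystem

/-- A Banach bundle over a locally compact Hausdorff space `X`: the total space is the disjoint
union `Σ x, E x` of Banach spaces, with a given topology and the canonical projection to `X`. The
limit condition for nets is expressed through filters. -/
structure IsBanachBundle {X : Type*} [TopologicalSpace X] [LocallyCompactSpace X] [T2Space X]
    (E : X → Type*) [∀ x, NormedAddCommGroup (E x)] [∀ x, NormedSpace ℂ (E x)]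
    [top : TopologicalSpace (Σ x, E x)] : Prop where
  t2Space : T2Space (Σ x, E x)
  continuous_proj : Continuous (Sigma.fst : (Σ x, E x) → X)
  isOpenMap_proj : IsOpenMap (Sigma.fst : (Σ x, E x) → X)
  completeSpace : ∀ x, CompleteSpace (E x)
  continuous_norm : Continuous fun s : Σ x, E x => ‖s.2‖
  continuous_add : Continuous fun p : {p : (Σ x, E x) × (Σ x, E x) // p.1.1 = p.2.1} =>
    (⟨p.1.2.1, (p.2 ▸ p.1.1.2) + p.1.2.2⟩ : Σ x, E x)
  continuous_smul : ∀ c : ℂ, Continuous fun s : Σ x, E x => (⟨s.1, c • s.2⟩ : Σ x, E x)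
  le_nhds_zero : ∀ (x : X) (l : Filter (Σ x, E x)),
    Filter.Tendsto (fun s : Σ x, E x => ‖s.2‖) l (nhds 0) →
    Filter.Tendsto Sigma.fst l (nhds x) → l ≤ nhds ⟨x, 0⟩

/-- A Fell bundle over a locally compact Hausdorff group `G` with fibers `E g`, multiplication
maps `mul g h : E g → E h → E (g * h)` and involution maps `inv g : E g → E g⁻¹`. Equations
between elements of `E g` and `E h`, where `g = h` holds in `G`, are stated in `Σ g, E g`. The
condition `s⋆ s ≥ 0` in the C⋆-algebra `E 1` is expressed as `s⋆ s = c⋆ c` for some `c : E 1`. -/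
structure IsFellBundle {G : Type*} [Group G] [TopologicalSpace G] [IsTopologicalGroup G]
    [LocallyCompactSpace G] [T2Space G]
    (E : G → Type*) [∀ g, NormedAddCommGroup (E g)] [∀ g, NormedSpace ℂ (E g)]
    [top : TopologicalSpace (Σ g, E g)]
    (mul : ∀ g h, E g → E h → E (g * h)) (inv : ∀ g, E g → E g⁻¹) : Prop
    extends IsBanachBundle E where
  continuous_mul : Continuous fun p : (Σ g, E g) × (Σ g, E g) =>
    (⟨p.1.1 * p.2.1, mul p.1.1 p.2.1 p.1.2 p.2.2⟩ : Σ g, E g)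
  continuous_inv : Continuous fun s : Σ g, E g => (⟨s.1⁻¹, inv s.1 s.2⟩ : Σ g, E g)
  mul_assoc : ∀ g h k (s : E g) (t : E h) (u : E k),
    (⟨g * h * k, mul (g * h) k (mul g h s t) u⟩ : Σ g, E g) =
      ⟨g * (h * k), mul g (h * k) s (mul h k t u)⟩
  add_mul : ∀ g h (s s' : E g) (t : E h), mul g h (s + s') t = mul g h s t + mul g h s' t
  mul_add : ∀ g h (s : E g) (t t' : E h), mul g h s (t + t') = mul g h s t + mul g h s t'
  smul_mul : ∀ g h (c : ℂ) (s : E g) (t : E h), mul g h (c • s) t = c • mul g h s t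
  mul_smul : ∀ g h (c : ℂ) (s : E g) (t : E h), mul g h s (c • t) = c • mul g h s t
  norm_mul_le : ∀ g h (s : E g) (t : E h), ‖mul g h s t‖ ≤ ‖s‖ * ‖t‖
  inv_add : ∀ g (s t : E g), inv g (s + t) = inv g s + inv g t
  inv_smul : ∀ g (c : ℂ) (s : E g), inv g (c • s) = star c • inv g s
  inv_mul : ∀ g h (s : E g) (t : E h),
    (⟨(g * h)⁻¹, inv (g * h) (mul g h s t)⟩ : Σ g, E g) =
      ⟨h⁻¹ * g⁻¹, mul h⁻¹ g⁻¹ (inv h t) (inv g s)⟩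
  inv_inv : ∀ g (s : E g), (⟨g⁻¹⁻¹, inv g⁻¹ (inv g s)⟩ : Σ g, E g) = ⟨g, s⟩
  norm_inv_mul_self : ∀ g (s : E g), ‖mul g⁻¹ g (inv g s) s‖ = ‖s‖ ^ 2
  inv_mul_self_nonneg : ∀ g (s : E g), ∃ c : E 1,
    (⟨g⁻¹ * g, mul g⁻¹ g (inv g s) s⟩ : Σ g, E g) = ⟨1⁻¹ * 1, mul 1⁻¹ 1 (inv 1 c) c⟩

/-- Saturation: the linear span of `E g * E h` is dense in `E (g * h)`. -/
def IsSaturated {G : Type*} [Group G] (E : G → Type*) [∀ g, NormedAddCommGroup (E g)]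
    [∀ g, NormedSpace ℂ (E g)] (mul : ∀ g h, E g → E h → E (g * h)) : Prop :=
  ∀ g h, Dense (Submodule.span ℂ {x : E (g * h) | ∃ s t, mul g h s t = x} : Set (E (g * h)))

/-- The linear bijection `ι : B ≃ E 1` identifies the C⋆-algebra `B` with the unit fiber: it is
multiplicative, involutive and isometric for the operations of the bundle. -/
structure IsUnitFiber {G : Type*} [Group G] (E : G → Type*) [∀ g, NormedAddCommGroup (E g)]
    [∀ g, NormedSpace ℂ (E g)] (mul : ∀ g h, E g → E h → E (g * h)) (inv : ∀ g, E g → E g⁻¹)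
    {B : Type*} [CStarAlgebra B] (ι : B ≃ₗ[ℂ] E 1) : Prop where
  map_mul : ∀ a b, (⟨1 * 1, mul 1 1 (ι a) (ι b)⟩ : Σ g, E g) = ⟨1, ι (a * b)⟩
  map_star : ∀ a, (⟨1⁻¹, inv 1 (ι a)⟩ : Σ g, E g) = ⟨1, ι (star a)⟩
  norm_map : ∀ a, ‖ι a‖ = ‖a‖

end

/-! ### Nondegeneracy of the inner products, faithfulness of the action, automatic adjointability -/

namespace MoritaBimodule

open scoped RightActions

variable {B : Type u} [CStarAlgebra B] [PartialOrder B] [StarOrderedRing B]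
  {M N : MoritaBimodule B}

/-! The involution is governed by one relation: `p` is the adjoint of `s` exactly when `s t = ι⟨p,
t⟩` for all `t`, where `ι : B → B_e` is the identification `unitEquiv` and `⟨·,·⟩` is the right
inner product. This is `IsInv`. Since `B` is unital, every Morita bimodule has a finite frame `w`
with `∑ innerL (w i) (w i) = 1`. Hence every right `B`-linear map is adjointable
(`isAdjointable_of_map_smul`), in particular every `λ_s`, and evaluating the adjoint at `1` gives an
element satisfying the relation (`isInv_inv`). Nondegeneracy of the inner product makes it unique
(`IsInv.unique`).

The algebraic laws of the involution become closure properties of this relation. It is symmetric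
(`IsInv.symm`), which gives `s** = s` and also `s* t = ι⟨s, t⟩`. It is compatible with products
(`IsInv.mul`), which gives `(st)* = t* s*`. From `s* s = ι⟨s, s⟩` the C⋆-identity and positivity are
read off the Hilbert module axioms. These arguments rest on associativity, on the fact that `Ψ`
preserves right inner products, so `⟨st, s't'⟩ = ⟨t, ⟨s, s'⟩ t'⟩`, and on the fact that `ι` acts by
the module actions (`unitEquiv_mulTo`, `mulTo_unitEquiv`), which is deduced from `Ψ_{e,e} = id`
alone.

The remaining claims are softer. `Ψ` is isometric, so the product is submultiplicative. `Ψ` is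
surjective, so the products span each fiber. The base is discrete, so continuity only has to be
checked on fixed fibers. -/

lemma innerR_zero_right (x : M) : M.innerR x 0 = 0 :=
  map_zero (M.innerRHom x)

lemma innerR_sub_right (x y z : M) : M.innerR x (y - z) = M.innerR x y - M.innerR x z :=
  map_sub (M.innerRHom x) y z

lemma innerR_complex_smul_left (c : ℂ) (x y : M) :
    M.innerR (c • x) y = star c • M.innerR x y := by
  rw [← M.smul_algebraMap', M.innerR_smul_left, Algebra.algebraMap_eq_smul_one, star_smul, star_one,
    smul_one_mul]

lemma eq_of_innerR_left {x y : M} (h : ∀ z, M.innerR z x = M.innerR z y) : x = y := by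
  rw [← sub_eq_zero, ← norm_eq_zero, ← sq_eq_zero_iff, M.norm_sq_eq_innerR, M.innerR_sub_right, h,
    sub_self, norm_zero]

lemma eq_of_innerR_right {x y : M} (h : ∀ z, M.innerR x z = M.innerR y z) : x = y :=
  eq_of_innerR_left fun z => by rw [← M.star_innerR, h, M.star_innerR]

/-- `B` acts faithfully from the left on a Morita equivalence `B`-bimodule. -/
lemma eq_of_smul_eq {a b : B} (h : ∀ x : M, a • x = b • x) : a = b := by
  obtain ⟨n, w, hw⟩ := M.exists_frame_left
  -- With a frame, `a = a * ∑ innerL (w i) (w i) = ∑ innerL (a • w i) (w i)` depends only on the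
  -- action of `a`.
  rw [← mul_one a, ← mul_one b, ← hw]
  simp only [Finset.mul_sum, ← M.innerL_smul_left, h]

/-- A right `B`-linear map between Morita equivalence bimodules is adjointable. -/
lemma isAdjointable_of_map_smul (T : M → N) (hadd : ∀ x y, T (x + y) = T x + T y)
    (hsmul : ∀ (b : B) x, T (x <• b) = T x <• b) : IsAdjointable T := by
  obtain ⟨n, w, hw⟩ := M.exists_frame_left
  -- The adjoint is forced: expanding `T⋆ y` in the frame gives coefficients `⟨w i, T⋆ y⟩ = ⟨T (w
  -- i), y⟩`.
  refine ⟨fun y => ∑ i, w i <• N.innerR (T (w i)) y, fun x y => ?_⟩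
  have hT : T x = ∑ i, T (w i) <• M.innerR (w i) x := by
    simp only [← hsmul]
    exact (congrArg T (sum_smul_innerR hw x).symm).trans (map_sum (AddMonoidHom.mk' T hadd) _ _)
  rw [hT, ← N.star_innerR, N.innerR_sum_right, star_sum, M.innerR_sum_right]
  refine Finset.sum_congr rfl fun i _ => ?_
  rw [N.star_innerR, N.innerR_smul_left, M.innerR_smul_right, M.star_innerR]

lemma isAdjoint_adjoint {T : M → N} (h : IsAdjointable T) : IsAdjoint T (adjoint T) := by
  rw [adjoint, dif_pos h]
  exact h.choose_spec

lemma Iso.norm_map (f : Iso M N) (x : M) : ‖f x‖ = ‖x‖ := by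
  rw [← sq_eq_sq₀ (norm_nonneg _) (norm_nonneg _), N.norm_sq_eq_innerR, M.norm_sq_eq_innerR,
    f.innerR_map]

end MoritaBimodule

/-! ### Disjoint unions of Banach spaces over a discrete base -/

section discreteBundle

variable {X : Type*} (E : X → Type*) [∀ x, NormedAddCommGroup (E x)]

open Classical in
/-- The projection of `Σ x, E x` onto the fiber `E x`, equal to `0` on the other fibers. -/
noncomputable def fiberProj (x : X) (s : Σ x, E x) : E x :=
  if h : s.1 = x then h ▸ s.2 else 0

@[simp] lemma fiberProj_self (x : X) (a : E x) : fiberProj E x ⟨x, a⟩ = a := dif_pos rfl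

lemma continuous_fiberProj (x : X) : Continuous (fiberProj E x) := by
  refine continuous_sigma fun y => ?_
  by_cases h : y = x
  · subst h
    simpa only [fiberProj_self] using continuous_id'
  · simpa [fiberProj, h] using continuous_const

/-- Fibers are open in the disjoint union. This localizes continuity statements to fixed fibers,
where `fiberProj` replaces the dependent second component. -/
lemma eventually_fst_eq (x : X) (a : E x) : ∀ᶠ s in nhds (⟨x, a⟩ : Σ x, E x), s.1 = x := by
  rw [Sigma.nhds_mk]
  exact Filter.eventually_map.2 (Filter.Eventually.of_forall fun _ => rfl)

/-- Over a discrete space, the disjoint union of Banach spaces is a Banach bundle. -/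
lemma isBanachBundle_of_discreteTopology [TopologicalSpace X] [DiscreteTopology X] [∀ x, NormedSpace ℂ (E x)]
    (hE : ∀ x, CompleteSpace (E x)) : IsBanachBundle E where
  t2Space := inferInstance
  continuous_proj := continuous_sigma fun _ => continuous_const
  isOpenMap_proj _ _ := isOpen_discrete _
  completeSpace := hE
  continuous_norm := continuous_sigma fun _ => continuous_norm
  continuous_add := by
    refine continuous_iff_continuousAt.2 fun ⟨⟨⟨x, a⟩, ⟨y, b⟩⟩, h⟩ => ?_
    -- Near the given point the base point stays equal to `x`, so the fiberwise sum agrees with the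
    -- sum of the two projections to `E x`, taken in one fixed normed space.
    refine (continuous_sigmaMk.comp
      (((continuous_fiberProj E x).comp (continuous_fst.comp continuous_subtype_val)).add
        ((continuous_fiberProj E x).comp
          (continuous_snd.comp continuous_subtype_val)))).continuousAt.congr ?_
    filter_upwards [(continuous_fst.comp continuous_subtype_val).continuousAt.eventually
      (eventually_fst_eq E x a)]
    rintro ⟨⟨⟨x, s⟩, ⟨y, t⟩⟩, hxy⟩ rfl
    obtain rfl : x = y := hxy
    simp
  continuous_smul c := continuous_sigma fun x =>
    continuous_sigmaMk.comp (continuous_const_smul c)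
  le_nhds_zero x l hl hx := by
    -- In a discrete base, convergence to `x` means lying eventually in the fiber over `x`. There,
    -- norms tending to zero is convergence to zero in `E x`.
    rw [nhds_discrete, Filter.tendsto_pure] at hx
    have h0 : Filter.Tendsto (fiberProj E x) l (nhds 0) := by
      refine tendsto_zero_iff_norm_tendsto_zero.2 (hl.congr' ?_)
      filter_upwards [hx]
      rintro ⟨y, s⟩ rfl
      simp
    refine Filter.tendsto_id'.1 (((continuous_sigmaMk.tendsto _).comp h0).congr' ?_)
    filter_upwards [hx]
    rintro ⟨y, s⟩ rfl
    simp

end discreteBundle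

/-! ### Bilinearity, inner products and norms of products -/

namespace FactorSystem

open MoritaBimodule
open scoped RightActions

variable {G : Type*} [Group G] {B : Type u} [CStarAlgebra B] [PartialOrder B] [StarOrderedRing B]
  {ψ : G →* Pic B} (F : FactorSystem ψ)

lemma add_mul (g h : G) (s s' : F.fiber g) (t : F.fiber h) :
    F.mul g h (s + s') t = F.mul g h s t + F.mul g h s' t :=
  (congrArg (F.mulIso g h) (add_tmul s s' t)).trans (map_add (F.mulIso g h).toLinearEquiv _ _)

lemma mul_add (g h : G) (s : F.fiber g) (t t' : F.fiber h) :
    F.mul g h s (t + t') = F.mul g h s t + F.mul g h s t' :=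
  (congrArg (F.mulIso g h) (tmul_add s t t')).trans (map_add (F.mulIso g h).toLinearEquiv _ _)

lemma smul_mul (g h : G) (b : B) (s : F.fiber g) (t : F.fiber h) :
    F.mul g h (b • s) t = b • F.mul g h s t :=
  (F.mulIso g h).smul_left b (tmul s t : TensorCarrier _ _)

lemma mul_smul (g h : G) (b : B) (s : F.fiber g) (t : F.fiber h) :
    F.mul g h s (t <• b) = F.mul g h s t <• b :=
  (F.mulIso g h).smul_right b (tmul s t : TensorCarrier _ _)

lemma complex_smul_mul (g h : G) (c : ℂ) (s : F.fiber g) (t : F.fiber h) :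
    F.mul g h (c • s) t = c • F.mul g h s t := by
  rw [← algebraMap_smul', smul_mul, algebraMap_smul']

lemma mul_complex_smul (g h : G) (c : ℂ) (s : F.fiber g) (t : F.fiber h) :
    F.mul g h s (c • t) = c • F.mul g h s t := by
  rw [← smul_algebraMap', mul_smul, smul_algebraMap']

lemma innerR_mul (g h : G) (s s' : F.fiber g) (t t' : F.fiber h) :
    (F.fiber (g * h)).innerR (F.mul g h s t) (F.mul g h s' t') =
      (F.fiber h).innerR t ((F.fiber g).innerR s s' • t') :=
  (F.mulIso g h).innerR_map _ _

lemma norm_mul_le (g h : G) (s : F.fiber g) (t : F.fiber h) :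
    ‖F.mul g h s t‖ ≤ ‖s‖ * ‖t‖ :=
  ((F.mulIso g h).norm_map (tmul s t : TensorCarrier _ _)).trans_le (norm_tmul_le s t)

/-- `Ψ_{g,h}` is onto and its domain is the algebraic balanced tensor product, so finite sums of
products already exhaust the fiber and no density argument is needed. -/
lemma mul_induction {g h : G} {p : F.fiber (g * h) → Prop} (x : F.fiber (g * h))
    (zero : p 0) (mul : ∀ s t, p (F.mul g h s t)) (add : ∀ x y, p x → p y → p (x + y)) : p x := by
  obtain ⟨x, rfl⟩ := (F.mulIso g h).toLinearEquiv.surjective x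
  change TensorCarrier (F.fiber g) (F.fiber h) at x
  induction x using tensor_induction with
  | zero => exact (map_zero (F.mulIso g h).toLinearEquiv).symm ▸ zero
  | tmul s t => exact mul s t
  | add x y hx hy => exact (map_add (F.mulIso g h).toLinearEquiv x y).symm ▸ add _ _ hx hy

lemma norm_unitEquiv (b : B) : ‖F.unitEquiv b‖ = ‖b‖ := F.unitIso.norm_map b

lemma innerR_unitEquiv (a b : B) :
    (F.fiber 1).innerR (F.unitEquiv a) (F.unitEquiv b) = star a * b :=
  F.unitIso.innerR_map a b

lemma smul_unitEquiv (a b : B) : a • F.unitEquiv b = F.unitEquiv (a * b) :=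
  (F.unitIso.smul_left a b).symm

lemma unitEquiv_smul (a b : B) : F.unitEquiv a <• b = F.unitEquiv (a * b) :=
  (F.unitIso.smul_right b a).symm

/-! ### Products with a prescribed target degree, and the action of the unit fiber -/

/-- The multiplication `B_g × B_h → B_k` for `g * h = k`. -/
noncomputable def mulTo {g h k : G} (e : g * h = k) (s : F.fiber g) (t : F.fiber h) : F.fiber k :=
  e ▸ F.mul g h s t

variable {F} {g h k : G}

lemma mk_mulTo (e : g * h = k) (s : F.fiber g) (t : F.fiber h) :
    (⟨k, F.mulTo e s t⟩ : Σ g, F.fiber g) = ⟨g * h, F.mul g h s t⟩ := by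
  subst e; rfl

lemma mulTo_add (e : g * h = k) (s : F.fiber g) (t t' : F.fiber h) :
    F.mulTo e s (t + t') = F.mulTo e s t + F.mulTo e s t' := by
  subst e; exact F.mul_add g h s t t'

lemma add_mulTo (e : g * h = k) (s s' : F.fiber g) (t : F.fiber h) :
    F.mulTo e (s + s') t = F.mulTo e s t + F.mulTo e s' t := by
  subst e; exact F.add_mul g h s s' t

lemma smul_mulTo (e : g * h = k) (b : B) (s : F.fiber g) (t : F.fiber h) :
    F.mulTo e (b • s) t = b • F.mulTo e s t := by
  subst e; exact F.smul_mul g h b s t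

lemma mulTo_smul (e : g * h = k) (b : B) (s : F.fiber g) (t : F.fiber h) :
    F.mulTo e s (t <• b) = F.mulTo e s t <• b := by
  subst e; exact F.mul_smul g h b s t

lemma innerR_mulTo (e : g * h = k) (s s' : F.fiber g) (t t' : F.fiber h) :
    (F.fiber k).innerR (F.mulTo e s t) (F.mulTo e s' t') =
      (F.fiber h).innerR t ((F.fiber g).innerR s s' • t') := by
  subst e; exact F.innerR_mul g h s s' t t'

lemma norm_mulTo (e : g * h = k) (s : F.fiber g) (t : F.fiber h) :
    ‖F.mulTo e s t‖ = ‖F.mul g h s t‖ := by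
  subst e; rfl

lemma mulTo_induction (e : g * h = k) {p : F.fiber k → Prop} (x : F.fiber k)
    (zero : p 0) (mul : ∀ s t, p (F.mulTo e s t)) (add : ∀ x y, p x → p y → p (x + y)) : p x := by
  subst e; exact F.mul_induction x zero mul add

lemma mk_injective {x y : F.fiber g} (hxy : (⟨g, x⟩ : Σ g, F.fiber g) = ⟨g, y⟩) : x = y :=
  eq_of_heq (Sigma.mk.inj hxy).2

/-- The intermediate degrees are free, so associativity becomes an equation in a single fiber and
can be used for rewriting even where a product of degrees simplifies, for instance to `1`. -/
lemma mulTo_assoc {a c d : G} (e₁ : g * h = a) (e₂ : a * k = d) (e₃ : h * k = c)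
    (e₄ : g * c = d) (s : F.fiber g) (t : F.fiber h) (u : F.fiber k) :
    F.mulTo e₂ (F.mulTo e₁ s t) u = F.mulTo e₄ s (F.mulTo e₃ t u) := by
  subst e₁ e₃
  refine mk_injective ?_
  rw [mk_mulTo, mk_mulTo]
  exact F.assoc g h k s t u

lemma mulTo_unitEquiv_unitEquiv (e : (1 : G) * 1 = 1) (a b : B) :
    F.mulTo e (F.unitEquiv a) (F.unitEquiv b) = F.unitEquiv (a * b) :=
  mk_injective ((mk_mulTo _ _ _).trans (F.mulIso_one_one a b))

/-- Left multiplication by `ι 1` preserves right inner products, since `⟨ι 1, ι 1⟩ = 1`, so it is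
injective. It is idempotent by associativity and `Ψ_{e,e} = id`. An injective idempotent map is the
identity, and left `B`-linearity gives the case of general `b`. -/
lemma unitEquiv_mulTo (e : 1 * g = g) (b : B) (t : F.fiber g) :
    F.mulTo e (F.unitEquiv b) t = b • t := by
  have hinj : ∀ x y : F.fiber g,
      F.mulTo e (F.unitEquiv 1) x = F.mulTo e (F.unitEquiv 1) y → x = y := by
    refine fun x y hxy => eq_of_innerR_left fun z => ?_
    have := congrArg ((F.fiber g).innerR (F.mulTo e (F.unitEquiv 1) z)) hxy
    simpa only [innerR_mulTo, innerR_unitEquiv, star_one, mul_one, one_smul] using this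
  have hone : F.mulTo e (F.unitEquiv 1) t = t := hinj _ _ <| by
    rw [← mulTo_assoc (one_mul 1) e e e, mulTo_unitEquiv_unitEquiv, mul_one]
  rw [← mul_one b, ← smul_unitEquiv, smul_mulTo, hone, mul_one]

/-- The mirror image: right multiplication by `ι 1` preserves right inner products because `⟨ι 1, c
• ι 1⟩ = c`, and it is idempotent. -/
lemma mulTo_unitEquiv (e : g * 1 = g) (s : F.fiber g) (b : B) :
    F.mulTo e s (F.unitEquiv b) = s <• b := by
  have hinj : ∀ x y : F.fiber g,
      F.mulTo e x (F.unitEquiv 1) = F.mulTo e y (F.unitEquiv 1) → x = y := by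
    refine fun x y hxy => eq_of_innerR_left fun z => ?_
    have := congrArg ((F.fiber g).innerR (F.mulTo e z (F.unitEquiv 1))) hxy
    simpa only [innerR_mulTo, smul_unitEquiv, innerR_unitEquiv, star_one, mul_one, one_mul]
      using this
  have hone : F.mulTo e s (F.unitEquiv 1) = s := hinj _ _ <| by
    rw [mulTo_assoc e e (one_mul 1) e, mulTo_unitEquiv_unitEquiv, mul_one]
  rw [← one_mul b, ← unitEquiv_smul, mulTo_smul, hone, one_mul]

/-! ### The involution and its defining relation -/

/-- `p : B_h` satisfies `λ_s(t) = ⟨p, t⟩_B` for all `t : B_h`, where `s : B_g` and `g * h = 1`. -/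
def IsInv (e : g * h = 1) (s : F.fiber g) (p : F.fiber h) : Prop :=
  ∀ t, F.mulTo e s t = F.unitEquiv ((F.fiber h).innerR p t)

lemma leftMul_eq (s : F.fiber g) (t : F.fiber g⁻¹) :
    F.leftMul g s t = F.unitEquiv.symm (F.mulTo (mul_inv_cancel g) s t) := rfl

variable (F) in
lemma isAdjointable_leftMul (g : G) (s : F.fiber g) : IsAdjointable (F.leftMul g s) := by
  refine isAdjointable_of_map_smul _ (fun x y => ?_) fun b x => ?_
  · rw [leftMul_eq, mulTo_add, map_add]; rfl
  · refine F.unitEquiv.symm_apply_eq.2 ?_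
    refine Eq.trans ?_ (F.unitEquiv_smul (F.leftMul g s x) b)
    rw [leftMul_eq, LinearEquiv.apply_symm_apply]
    exact mulTo_smul _ _ _ _

variable (F) in
-- The adjunction tested against `1` reads `λ_s(t)* = ⟨t, s*⟩`; taking stars gives the relation.
lemma isInv_inv (g : G) (s : F.fiber g) : IsInv (mul_inv_cancel g) s (F.inv g s) := by
  intro t
  have h : star (F.unitEquiv.symm (F.mulTo (mul_inv_cancel g) s t)) * (1 : B) =
      (F.fiber g⁻¹).innerR t (F.inv g s) :=
    isAdjoint_adjoint (F.isAdjointable_leftMul g s) t (1 : B)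
  rw [← (F.fiber g⁻¹).star_innerR, ← h, mul_one, star_star, LinearEquiv.apply_symm_apply]

/-- The degrees `h` and `h'` agree by cancellation in `G`, and then nondegeneracy applies. Allowing
two expressions for the degree is what makes this usable for `g⁻¹⁻¹` versus `g` and `(g * h)⁻¹`
versus `h⁻¹ * g⁻¹`. -/
lemma IsInv.unique {h' : G} {e : g * h = 1} {e' : g * h' = 1} {s : F.fiber g} {p : F.fiber h}
    {q : F.fiber h'} (hp : IsInv e s p) (hq : IsInv e' s q) :
    (⟨h, p⟩ : Σ g, F.fiber g) = ⟨h', q⟩ := by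
  obtain rfl : h = h' := mul_left_cancel (e.trans e'.symm)
  congr 1
  exact eq_of_innerR_right fun t => F.unitEquiv.injective ((hp t).symm.trans (hq t))

lemma IsInv.eq_inv {s : F.fiber g} {p : F.fiber g⁻¹} (hp : IsInv (mul_inv_cancel g) s p) :
    F.inv g s = p :=
  mk_injective ((F.isInv_inv g s).unique hp)

/-- Both `p s'` and `ι⟨s, s'⟩` lie in the unit fiber, so by faithfulness they may be compared
through their left action on `t'` in the fiber of `p`. Associativity gives `(p s') t' = p (s' t') =
p ⟨s'*, t'⟩`, and the auxiliary identity `key` says that this is `⟨s, s'⟩ t'`. -/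
lemma IsInv.symm {e : g * h = 1} (e' : h * g = 1) {s : F.fiber g} {p : F.fiber h}
    (hp : IsInv e s p) : IsInv e' p s := by
  obtain rfl : h = g⁻¹ := eq_inv_of_mul_eq_one_right e
  intro s'
  -- Pairing with `t`: `⟨t, ⟨s, s'⟩ t'⟩ = ⟨s t, s' t'⟩ = ⟨p, t⟩* ⟨s'*, t'⟩ = ⟨t, p ⟨s'*, t'⟩⟩`.
  have key : ∀ t', (F.fiber g).innerR s s' • t' =
      p <• (F.fiber g⁻¹).innerR (F.inv g s') t' := fun t' => by
    refine eq_of_innerR_left fun t => ?_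
    rw [← innerR_mulTo e, hp, F.isInv_inv g s', innerR_unitEquiv, (F.fiber g⁻¹).star_innerR,
      (F.fiber g⁻¹).innerR_smul_right]
  obtain ⟨b, hb⟩ := F.unitEquiv.surjective (F.mulTo e' p s')
  rw [← hb]
  congr 1
  refine eq_of_smul_eq (M := F.fiber g⁻¹) fun t' => ?_
  rw [key, ← unitEquiv_mulTo (one_mul _), hb, mulTo_assoc (c := 1) e' (one_mul _) e (mul_one _),
      F.isInv_inv g s', mulTo_unitEquiv]

/-- Since products `u v` span the fiber over `h' * g'`, it suffices to compute `(s t)(u v) = s ((t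
u) v) = s (⟨t', u⟩ v) = ι⟨s', ⟨t', u⟩ v⟩ = ι⟨t' s', u v⟩`. -/
lemma IsInv.mul {g' h' k' : G} {eg : g * g' = 1} {eh : h * h' = 1} (ek : k * k' = 1)
    (e : g * h = k) (e' : h' * g' = k') {s : F.fiber g} {s' : F.fiber g'} {t : F.fiber h}
    {t' : F.fiber h'} (hs : IsInv eg s s') (ht : IsInv eh t t') :
    IsInv ek (F.mulTo e s t) (F.mulTo e' t' s') := by
  intro x
  induction x using mulTo_induction e' with
  | zero =>
    rw [innerR_zero_right, map_zero]
    -- Additivity at `0 + 0` forces the product with `0` to vanish.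
    simpa using mulTo_add ek (F.mulTo e s t) 0 0
  | add x y hx hy => rw [mulTo_add, hx, hy, (F.fiber k').innerR_add_right, map_add]
  | mul u v =>
    have e₁ : h * k' = g' := by rw [← e', ← mul_assoc, eh, one_mul]
    rw [mulTo_assoc e ek e₁ eg, ← mulTo_assoc eh (one_mul g') e' e₁, ht, unitEquiv_mulTo, hs,
      innerR_mulTo]

lemma inv_add (s t : F.fiber g) : F.inv g (s + t) = F.inv g s + F.inv g t :=
  IsInv.eq_inv fun x => by
    rw [add_mulTo, F.isInv_inv g s, F.isInv_inv g t, innerR_add_left, map_add]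

lemma inv_smul (c : ℂ) (s : F.fiber g) : F.inv g (c • s) = star c • F.inv g s :=
  IsInv.eq_inv fun x => by
    rw [← algebraMap_smul', smul_mulTo, F.isInv_inv g s, innerR_complex_smul_left, star_star,
      algebraMap_smul', map_smul]

/-- Symmetry of the relation applied to `s` and `s*`. At `t = s` it is the source of both the
C⋆-identity and the positivity of `s* s`. -/
lemma inv_mulTo_self (e : g⁻¹ * g = 1) (s t : F.fiber g) :
    F.mulTo e (F.inv g s) t = F.unitEquiv ((F.fiber g).innerR s t) :=
  (F.isInv_inv g s).symm e t

/-- Taking `t = s*` in the defining relation gives `‖s*‖² = ‖⟨s*, s*⟩‖ = ‖s s*‖ ≤ ‖s‖ ‖s*‖`, and a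
nonzero `‖s*‖` cancels. This bound gives continuity of the involution on each fiber. -/
lemma norm_inv_le (s : F.fiber g) : ‖F.inv g s‖ ≤ ‖s‖ := by
  rcases (norm_nonneg (F.inv g s)).eq_or_lt with h0 | h0
  · rw [← h0]; exact norm_nonneg s
  · refine le_of_mul_le_mul_right ?_ h0
    rw [← sq, (F.fiber g⁻¹).norm_sq_eq_innerR, ← F.norm_unitEquiv, ← F.isInv_inv g s, norm_mulTo]
    exact F.norm_mul_le _ _ _ _

/-! ### Continuity and assembly of the saturated Fell bundle -/

variable (F) in
lemma continuous_mul (g h : G) :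
    Continuous fun p : F.fiber g × F.fiber h => F.mul g h p.1 p.2 :=
  ((LinearMap.mk₂ ℂ (F.mul g h) (F.add_mul g h) (F.complex_smul_mul g h) (F.mul_add g h)
    (F.mul_complex_smul g h)).mkContinuous₂ 1 fun s t => by
      rw [one_mul]; exact F.norm_mul_le g h s t).continuous₂

variable (F) in
lemma continuous_inv (g : G) : Continuous (F.inv g) :=
  AddMonoidHomClass.continuous_of_bound (AddMonoidHom.mk' (F.inv g) inv_add) 1
    fun s => (norm_inv_le s).trans_eq (one_mul _).symm

variable (F) in
lemma isFellBundle [TopologicalSpace G] [DiscreteTopology G] :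
    IsFellBundle (fun g => F.fiber g) F.mul F.inv where
  toIsBanachBundle := isBanachBundle_of_discreteTopology _ fun _ => inferInstance
  continuous_mul := by
    refine continuous_iff_continuousAt.2 fun ⟨⟨g, x⟩, ⟨h, y⟩⟩ => ?_
    -- Near the given pair both degrees are constant, so the multiplication agrees locally with a
    -- single bounded bilinear map composed with the fiber projections.
    refine ((continuous_sigmaMk (σ := fun g => F.fiber g)).comp ((F.continuous_mul g h).comp
      (((continuous_fiberProj _ g).comp continuous_fst).prodMk
        ((continuous_fiberProj _ h).comp continuous_snd)))).continuousAt.congr ?_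
    filter_upwards [(continuous_fst.tendsto _).eventually (eventually_fst_eq (fun g => F.fiber g) g x),
      (continuous_snd.tendsto _).eventually (eventually_fst_eq (fun g => F.fiber g) h y)]
    rintro ⟨⟨g, s⟩, ⟨h, t⟩⟩ rfl rfl
    simp
  continuous_inv := continuous_sigma fun g =>
    (continuous_sigmaMk (σ := fun g => F.fiber g)).comp (F.continuous_inv g)
  mul_assoc := F.assoc
  add_mul := F.add_mul
  mul_add := F.mul_add
  smul_mul := F.complex_smul_mul
  mul_smul := F.mul_complex_smul
  norm_mul_le := F.norm_mul_le
  inv_add _ := inv_add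
  inv_smul _ := inv_smul
  inv_mul g h s t := (F.isInv_inv (g * h) _).unique <|
    IsInv.mul (by group) rfl rfl (F.isInv_inv g s) (F.isInv_inv h t)
  -- By symmetry `s` is an adjoint of `s*`, and so is `s**`.
  inv_inv g s := (F.isInv_inv g⁻¹ _).unique ((F.isInv_inv g s).symm (inv_mul_cancel g))
  norm_inv_mul_self g s := by
    rw [← norm_mulTo (inv_mul_cancel g), inv_mulTo_self, norm_unitEquiv,
      (F.fiber g).norm_sq_eq_innerR]
  inv_mul_self_nonneg g s := by
    obtain ⟨c, hc⟩ := CStarAlgebra.nonneg_iff_eq_star_mul_self.1 ((F.fiber g).innerR_self_nonneg s)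
    -- With `⟨s, s⟩ = c* c` in `B`, both `s* s` and `(ι c)* (ι c)` equal `ι(c* c)`.
    refine ⟨F.unitEquiv c, ?_⟩
    rw [← mk_mulTo (inv_mul_cancel g), ← mk_mulTo (inv_mul_cancel 1), inv_mulTo_self,
      inv_mulTo_self, innerR_unitEquiv, hc]

variable (F) in
lemma isSaturated : IsSaturated (fun g => F.fiber g) F.mul := by
  intro g h
  refine dense_univ.mono fun x _ => ?_
  induction x using F.mul_induction with
  | zero => exact zero_mem _
  | add x y hx hy => exact add_mem (hx trivial) (hy trivial)
  | mul s t => exact Submodule.subset_span ⟨s, t, rfl⟩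

variable (F) in
lemma isUnitFiber : IsUnitFiber (fun g => F.fiber g) F.mul F.inv F.unitEquiv where
  map_mul := F.mulIso_one_one
  -- `ι(a*)` satisfies the defining relation for `ι a`, because `ι a · ι b = ι(ab)` and `⟨ι(a*), ι
  -- b⟩ = ab`.
  map_star a := (F.isInv_inv 1 _).unique (e' := one_mul 1) fun t => by
    obtain ⟨b, rfl⟩ := F.unitEquiv.surjective t
    rw [mulTo_unitEquiv_unitEquiv, innerR_unitEquiv, star_star]
  norm_map := F.norm_unitEquiv

end FactorSystem

/-- The total space `Σ g, B_g` carries the disjoint union topology of the norm topologies. -/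
theorem mainTheorem3 {G : Type*} [Group G] [TopologicalSpace G] [DiscreteTopology G]
    {B : Type u} [CStarAlgebra B] [PartialOrder B] [StarOrderedRing B]
    (ψ : G →* Pic B) (F : FactorSystem ψ) :
    (∀ (g : G) (s : F.fiber g), MoritaBimodule.IsAdjointable (F.leftMul g s)) ∧
    IsFellBundle (fun g => F.fiber g) F.mul F.inv ∧
    IsSaturated (fun g => F.fiber g) F.mul ∧
    IsUnitFiber (fun g => F.fiber g) F.mul F.inv F.unitEquiv :=
  ⟨F.isAdjointable_leftMul, F.isFellBundle, F.isSaturated, F.isUnitFiber⟩
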